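/- Let $\mathbb{F}_q$ be a finite field of characteristic greater than $3$, let $\mathcal{O}=\mathbb{F}_q[t]$, and let $\mathcal{O}^+\subset\mathcal{O}$ be the set of monic polynomials. Let $K_\infty=\mathbb{F}_q((t^{-1}))$, with the absolute value $|\sum_{i\le N}a_it^i|=q^N$ for $a_N\ne 0$ (and $|0|=0$), extended to $K_\infty^n$ by taking the maximum over the coordinates. Let $\mathrm{d}\alpha$ be the Haar measure on $K_\infty$ for which $\{\alpha:|\alpha|<1\}$ has measure $1$, let $\mathrm{d}\mathbf{x}$ be the product measure on $K_\infty^n$, and let $\psi(\sum_i a_it^i)=\exp\big(2\pi i\,\mathrm{Tr}_{\mathbb{F}_q/\mathbb{F}_p}(a_{-1})/p\big)$, where $p=\mathrm{char}(\mathbb{F}_q)$. Let $n\ge 5$ and let $F(\mathbf{x})=a_1x_1^3+\dots+a_nx_n^3$ with $a_1,\dots,a_n\in\mathbb{F}_q^\times$. Let $w\colon K_\infty^n\to\mathbb{R}$ be a weight function of the following kind: there are $\mathbf{x}_0\in K_\infty^n$ with $|\mathbf{x}_0|\le 1$ and an integer $L\ge 0$ such that $w(\mathbf{x})=1$ if $|\mathbf{x}-\mathbf{x}_0|<q^{-L}$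 and $w(\mathbf{x})=0$ otherwise, and the Hessian determinant of $F$ does not vanish at any point of the support of $w$. For $P\in\mathcal{O}\setminus\{0\}$, a real number $Q\ge 0$ and $r\in\mathcal{O}^+$, put $$S_r(\mathbf{0})=\sum_{\substack{a\in\mathcal{O},\ |a|<|r|\\ \gcd(a,r)=1}}\ \sum_{\substack{\mathbf{x}\in\mathcal{O}^n\\ |\mathbf{x}|<|r|}}\psi\Big(\frac{aF(\mathbf{x})}{r}\Big),\qquad I_r(\mathbf{0})=\int_{|\theta|<|r|^{-1}q^{-Q}}\int_{K_\infty^n}w(\mathbf{x})\,\psi\big(\theta P^3F(\mathbf{x})\big)\,\mathrm{d}\mathbf{x}\,\mathrm{d}\theta,$$ and let $$M(P)=|P|^n\sum_{\substack{r\in\mathcal{O}^+\\ |r|\le q^Q}}|r|^{-n}S_r(\mathbf{0})I_r(\mathbf{0}),$$ which is the contribution of $\mathbf{c}=\mathbf{0}$ to the delta-method expansion of $\sum_{\mathbf{x}\in\mathcal{O}^n,\,F(\mathbf{x})=0}w(\mathbf{x}/P)$. Then there is a constant $C>0$, depending only on $q$, $n$, $F$ and $w$ (and not on $P$ or $Q$),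 such that $$|M(P)|\le C\,|P|^{n-3}\qquad\text{for all } P\in\mathcal{O}\setminus\{0\}\text{ and all } Q\ge 0.$$ -/

import Mathlib

open MeasureTheory Polynomial

namespace CubicCentre

noncomputable section

/-- The field `K_∞ = 𝔽_q((t⁻¹))`. The variable of the Laurent series is `t⁻¹`, so that the
coefficient of `t^i` of a series `α` is `α.coeff (-i)`. Its topology is Mathlib's valuation
topology on Laurent series. -/
abbrev Kinf (k : Type*) [Field k] : Type _ := LaurentSeries k

/-- The embedding of `𝒪 = 𝔽_q[t]` into `K_∞`, which sends `t` to the inverse of the variable. -/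
def toKinf (k : Type*) [Field k] : k[X] →+* Kinf k :=
  Polynomial.eval₂RingHom HahnSeries.C (HahnSeries.single (-1 : ℤ) (1 : k))

/-- `q ^ M` for a real number `M`, where `q = #k`. -/
def hat (k : Type*) [Fintype k] (M : ℝ) : ℝ := (Fintype.card k : ℝ) ^ M

/-- The absolute value on `K_∞`: `|∑_{i ≤ M} a_i t^i| = q ^ M` when `a_M ≠ 0`, and `|0| = 0`. -/
def absK {k : Type*} [Field k] [Fintype k] (α : Kinf k) : ℝ :=
  open Classical in if α = 0 then 0 else hat k (-(α.order : ℝ))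

/-- The absolute value of a polynomial, as an element of `K_∞`. -/
def absO {k : Type*} [Field k] [Fintype k] (r : k[X]) : ℝ := absK (toKinf k r)

/-- The unit interval `𝕋 = {α ∈ K_∞ : |α| < 1}`. -/
def unitT (k : Type*) [Field k] [Fintype k] : Set (Kinf k) := {α | absK α < 1}

lemma mem_unitT_iff {k : Type*} [Field k] [Fintype k] (α : Kinf k) :
    α ∈ unitT k ↔ ∀ n : ℤ, n < 1 → α.coeff n = 0 := by
  have hq : (1 : ℝ) < Fintype.card k := by exact_mod_cast Fintype.one_lt_card
  unfold unitT absK hat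
  simp only [Set.mem_ofPred_eq]
  split_ifs with h
  · simp [h]
  · rw [Real.rpow_lt_one_iff_of_pos (by linarith)]
    constructor
    · rintro (⟨_, h1⟩ | ⟨h1, _⟩)
      · intro n hn
        apply HahnSeries.coeff_eq_zero_of_lt_order
        have : (0 : ℤ) < α.order := by exact_mod_cast (by linarith : (0 : ℝ) < (α.order : ℝ))
        omega
      · linarith
    · intro h1
      left
      refine ⟨hq, ?_⟩
      have : 0 < α.order := by
        by_contra h2
        exact HahnSeries.coeff_order_eq_zero.not.mpr h (h1 _ (by omega))
      have : (0 : ℝ) < (α.order : ℝ) := by exact_mod_cast this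
      linarith

lemma isOpen_unitT (k : Type*) [Field k] [Fintype k] : IsOpen (unitT k) := by
  have h0 : (Valued.v (HahnSeries.single (1 : ℤ) (1 : k) : LaurentSeries k) : WithZero (Multiplicative ℤ))
      = WithZero.exp (-1 : ℤ) := LaurentSeries.valuation_single_zpow k 1
  have h : unitT k = {α : Kinf k | Valued.v.restrict α ≤
      Valued.v.restrict (HahnSeries.single (1 : ℤ) (1 : k) : LaurentSeries k)} := by
    ext α
    rw [mem_unitT_iff, Set.mem_ofPred_eq, Valuation.restrict_le_iff, h0,
      LaurentSeries.valuation_le_iff_coeff_lt_eq_zero]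
  rw [h]
  refine Valued.isOpen_closedBall _ fun h1 => ?_
  have h2 := MonoidWithZeroHom.ValueGroup₀.restrict₀_eq_zero_iff.1 h1
  change Valued.v (HahnSeries.single (1 : ℤ) (1 : k) : LaurentSeries k) = 0 at h2
  rw [h0] at h2
  exact WithZero.exp_ne_zero h2

lemma isCompact_unitT (k : Type*) [Field k] [Fintype k] : IsCompact (unitT k) := by
  let _ : TopologicalSpace k := ⊥
  have _ : DiscreteTopology k := ⟨rfl⟩
  let f : (ℕ → k) → Kinf k := fun c =>
    HahnSeries.single (1 : ℤ) 1 * HahnSeries.ofPowerSeries ℤ k (PowerSeries.mk c)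
  have hcoeff : ∀ c (n : ℕ), (f c).coeff ((n : ℤ) + 1) = c n := by
    intro c n
    simp only [f]
    rw [HahnSeries.coeff_single_mul_add, one_mul, HahnSeries.ofPowerSeries_apply_coeff,
      PowerSeries.coeff_mk]
  have hcoeff0 : ∀ c (n : ℤ), n < 1 → (f c).coeff n = 0 := by
    intro c n hn
    simp only [f]
    rw [show n = (n - 1) + 1 by ring, HahnSeries.coeff_single_mul_add, one_mul,
      PowerSeries.coeff_coe, if_pos (by omega)]
  have hrange : Set.range f = unitT k := by
    ext α
    rw [mem_unitT_iff]
    constructor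
    · rintro ⟨c, rfl⟩ n hn
      exact hcoeff0 c n hn
    · intro h
      refine ⟨fun n => α.coeff ((n : ℤ) + 1), ?_⟩
      ext n
      by_cases hn : n < 1
      · rw [hcoeff0 _ _ hn, h n hn]
      · obtain ⟨m, rfl⟩ : ∃ m : ℕ, n = (m : ℤ) + 1 := ⟨(n - 1).toNat, by omega⟩
        rw [hcoeff]
  have hcont : Continuous f := by
    rw [continuous_iff_continuousAt]
    intro c U hU
    obtain ⟨γ, hU₁⟩ := Valued.mem_nhds.mp hU
    simp_rw [Valued.v.restrict_lt_iff_lt_embedding] at hU₁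
    set g := MonoidWithZeroHom.ValueGroup₀.embedding γ.1 with hg
    set D : ℤ := -(WithZero.log g - 1) with hD₀
    have hD : WithZero.exp (-D) < g := by
      rw [← WithZero.lt_log_iff_exp_lt (by simp [hg]), hD₀]
      simp
    rw [Filter.mem_map]
    have hV : (⋂ i ∈ Finset.range D.toNat, {d : ℕ → k | d i = c i}) ∈ nhds c := by
      rw [Filter.biInter_finset_mem]
      intro i _
      exact (continuous_apply i).continuousAt.preimage_mem_nhds
        (show {y : k | y = c i} ∈ nhds (c i) from mem_nhds_discrete.mpr rfl)
    refine Filter.mem_of_superset hV fun d hd => hU₁ ?_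
    refine lt_of_le_of_lt ((LaurentSeries.valuation_le_iff_coeff_lt_eq_zero k).mpr ?_) hD
    intro n hn
    rw [HahnSeries.coeff_sub, sub_eq_zero]
    by_cases h1 : n < 1
    · rw [hcoeff0 _ _ h1, hcoeff0 _ _ h1]
    · obtain ⟨m, rfl⟩ : ∃ m : ℕ, n = (m : ℤ) + 1 := ⟨(n - 1).toNat, by omega⟩
      rw [hcoeff, hcoeff]
      exact Set.mem_iInter₂.mp hd m (by simp; omega)
  rw [← hrange]
  exact isCompact_range hcont

/-- `K_∞` carries its Borel σ-algebra. -/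
instance (k : Type*) [Field k] : MeasurableSpace (Kinf k) := borel _

instance (k : Type*) [Field k] : BorelSpace (Kinf k) := ⟨rfl⟩

/-- `𝕋` as a compact set with non-empty interior. -/
def unitTCompacts (k : Type*) [Field k] [Fintype k] :
    TopologicalSpace.PositiveCompacts (Kinf k) where
  carrier := unitT k
  isCompact' := isCompact_unitT k
  interior_nonempty' := by
    rw [(isOpen_unitT k).interior_eq]
    exact ⟨0, by simp [mem_unitT_iff]⟩

/-- The Haar measure on `K_∞`, normalised by `∫_𝕋 dα = 1`. -/
def haarK (k : Type*) [Field k] [Fintype k] : Measure (Kinf k) :=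
  Measure.addHaarMeasure (unitTCompacts k)

/-- The product measure `d𝐱 = dx₁ ⋯ dxₙ` on `K_∞ⁿ`. -/
def haarKn (k : Type*) [Field k] [Fintype k] (n : ℕ) : Measure (Fin n → Kinf k) :=
  Measure.pi fun _ => haarK k

/-- The additive character `ψ(α) = e(Tr_{𝔽_q/𝔽_p}(a_{-1}) / p)` of `K_∞`, where `a_{-1}` is the
coefficient of `t⁻¹` in `α`. Here `ZMod.stdAddChar j = exp (2πi j / p)`. -/
def psi {k : Type*} [Field k] [Fintype k] (α : Kinf k) : ℂ :=
  letI : Algebra (ZMod (ringChar k)) k := ZMod.algebra k (ringChar k)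
  haveI : NeZero (ringChar k) := ⟨CharP.ringChar_ne_zero_of_finite k⟩
  ZMod.stdAddChar (Algebra.trace (ZMod (ringChar k)) k (α.coeff 1))

variable {k : Type*} [Field k] [Fintype k] {n : ℕ}

/-- The value at `𝐱 ∈ K_∞ⁿ` of a polynomial with coefficients in `𝒪`. -/
def evalK (F : MvPolynomial (Fin n) k[X]) (x : Fin n → Kinf k) : Kinf k :=
  MvPolynomial.eval₂ (toKinf k) x F

/-- The diagonal cubic form `a₁x₁³ + ⋯ + aₙxₙ³` with coefficients in `𝔽_q^×`. -/
def diagonalCubic (a : Fin n → kˣ) : MvPolynomial (Fin n) k[X] :=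
  ∑ i, MvPolynomial.C (Polynomial.C (a i : k)) * MvPolynomial.X i ^ 3

/-- The Hessian matrix of `F` at the point `𝐱 ∈ K_∞ⁿ`. -/
def hessian (F : MvPolynomial (Fin n) k[X]) (x : Fin n → Kinf k) :
    Matrix (Fin n) (Fin n) (Kinf k) :=
  Matrix.of fun i j => evalK (MvPolynomial.pderiv i (MvPolynomial.pderiv j F)) x

/-- The weight functions: `w` is the indicator function of a ball `|𝐱 - 𝐱₀| < q^{-L}`, where
`|𝐱₀| ≤ 1` and `L ≥ 0`, and the Hessian determinant of `F` does not vanish on the support of `w`.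
(`|·|` is the maximum of the absolute values of the coordinates.) -/
structure IsWeight (F : MvPolynomial (Fin n) k[X]) (w : (Fin n → Kinf k) → ℝ) : Prop where
  det_hessian_ne_zero : ∀ x ∈ Function.support w, (hessian F x).det ≠ 0
  eq_indicator : ∃ (x₀ : Fin n → Kinf k) (L : ℕ), (∀ i, absK (x₀ i) ≤ 1) ∧
    w = Set.indicator {x | ∀ i, absK (x i - x₀ i) < hat k (-(L : ℝ))} 1

/-- The complete exponential sum
`S_r(𝐜) = ∑'_{|a| < |r|} ∑_{|𝐱| < |r|} ψ((a F(𝐱) - 𝐜 · 𝐱) / r)`, where `a ∈ 𝒪` is coprime to `r`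
and `𝐱 ∈ 𝒪ⁿ`; both sums are finite. -/
def expSum (F : MvPolynomial (Fin n) k[X]) (r : k[X]) (c : Fin n → k[X]) : ℂ :=
  ∑ᶠ a ∈ {a : k[X] | absO a < absO r ∧ IsCoprime a r},
    ∑ᶠ x ∈ {x : Fin n → k[X] | ∀ i, absO (x i) < absO r},
      psi (toKinf k (a * MvPolynomial.eval x F - ∑ i, c i * x i) / toKinf k r)

/-- The oscillatory integral
`I_r(θ, 𝐜) = ∫_{K_∞ⁿ} w(𝐱) ψ(θ P³ F(𝐱) + P 𝐜 · 𝐱 / r) d𝐱`. -/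
def oscInt (F : MvPolynomial (Fin n) k[X]) (w : (Fin n → Kinf k) → ℝ) (P r : k[X])
    (θ : Kinf k) (c : Fin n → k[X]) : ℂ :=
  ∫ x, (w x : ℂ) * psi (θ * toKinf k P ^ 3 * evalK F x
    + toKinf k P * (∑ i, toKinf k (c i) * x i) / toKinf k r) ∂(haarKn k n)

/-- The average `I_r(𝐜) = ∫_{|θ| < |r|⁻¹ q^{-Q}} I_r(θ, 𝐜) dθ`. -/
def avgInt (F : MvPolynomial (Fin n) k[X]) (w : (Fin n → Kinf k) → ℝ) (P r : k[X])
    (Q : ℝ) (c : Fin n → k[X]) : ℂ :=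
  ∫ θ in {θ : Kinf k | absK θ < (absO r)⁻¹ * (hat k Q)⁻¹}, oscInt F w P r θ c ∂(haarK k)

/-- The contribution of `𝐜 = 𝟎`:
`M(P) = |P|ⁿ ∑_{r monic, |r| ≤ q^Q} |r|⁻ⁿ S_r(𝟎) I_r(𝟎)`, a finite sum. -/
def centreTerm (F : MvPolynomial (Fin n) k[X]) (w : (Fin n → Kinf k) → ℝ) (P : k[X])
    (Q : ℝ) : ℂ :=
  ((absO P ^ n : ℝ) : ℂ) * ∑ᶠ r ∈ {r : k[X] | r.Monic ∧ absO r ≤ hat k Q},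
    (((absO r ^ n)⁻¹ : ℝ) : ℂ) * expSum F r 0 * avgInt F w P r Q 0

end

end CubicCentre

/-!
The terms of `M(P)` are bounded in absolute value, and the sum over `r` is bounded by a convergent
series which involves neither `P` nor `Q`.

*The integrals.* For a diagonal form the integral over `𝐱` is a product of one-dimensional integrals
of `ψ(β x³)` over balls, with `β = θ P³ aᵢ`; each of them is at most `1` in absolute value. The
Hessian determinant is `∏ᵢ 6 aᵢ xᵢ`, so none of these balls contains `0`, and `|x|` is constant on
each. If `β` is large, then a translation `x ↦ x + c t^{-m}` at the right scale multiplies `ψ(β x³)`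
by a nontrivial character of `c ∈ 𝔽_q`, and averaging over `c` shows that the integral is `0`
(`integral_cubicPhase_eq_zero`). So only `|θ P³| ≪ 1` contributes, and `I_r(𝟎) = O(|P|⁻³)` uniformly
in `r` and `Q` (`exists_norm_avgInt_le`).

*The exponential sums.* It remains to bound `∑_r |r|⁻ⁿ |S_r(𝟎)|`. Again `S_r(𝟎)` is a sum of
products of one-dimensional sums `∑_{x mod r} φ(x³)`, where `φ` runs over characters of `𝔽_q[t]`
which are primitive modulo `r` (`HasLevel φ r`). With `γ(r) ≤ 1` the largest normalised size of
such a sum (`cubicSup`), `|r|⁻ⁿ |S_r(𝟎)| ≤ |r| γ(r)ⁿ ≤ |r| γ(r)⁵` for `n ≥ 5`. The Chinese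
remainder theorem makes `γ` submultiplicative. At a prime, `γ(π)² ≤ 18 / |π|`: this follows from
the mean square over all characters of the field `𝔽_q[t]/π`, because the sum depends only on the
class of the character modulo cubes (`sq_norm_cubicSum_field_le`). At higher prime powers,
summation over a residue class modulo `π^{m-1}` leaves only the multiples of `π`, whence `γ(π²) ≤
|π|⁻¹` and `γ(π^m) ≤ |π|⁻¹ γ(π^{m-3})`. Thus `|r| γ(r)⁵` is `O(|π|^{-3/2})` at every prime power,
with geometric decay in the exponent, and a finite Euler product bounds its sum by `exp(O(∑
|f|^{-3/2}))` (`exists_sum_seriesTerm_le`).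
-/

namespace CubicCentre

variable {k : Type*} [Field k] [Fintype k]

/-! ### The character `ψ` -/

/-- The additive character `c ↦ e(Tr(c) / p)` of `𝔽_q`, through which `ψ` factors. -/
noncomputable def traceChar (k : Type*) [Field k] [Fintype k] : AddChar k ℂ :=
  letI : Algebra (ZMod (ringChar k)) k := ZMod.algebra k (ringChar k)
  haveI : NeZero (ringChar k) := ⟨CharP.ringChar_ne_zero_of_finite k⟩
  ZMod.stdAddChar.compAddMonoidHom (Algebra.trace (ZMod (ringChar k)) k).toAddMonoidHom

lemma psi_eq_traceChar (α : Kinf k) : psi α = traceChar k (α.coeff 1) := rfl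

lemma exists_traceChar_mul_ne_one {c : k} (hc : c ≠ 0) : ∃ u : k, traceChar k (c * u) ≠ 1 := by
  let _ : Algebra (ZMod (ringChar k)) k := ZMod.algebra k (ringChar k)
  have _ : NeZero (ringChar k) := ⟨CharP.ringChar_ne_zero_of_finite k⟩
  obtain ⟨u, hu⟩ := FiniteField.trace_to_zmod_nondegenerate k hc
  refine ⟨u, fun h => hu ?_⟩
  refine ZMod.injective_stdAddChar ?_
  rw [AddChar.map_zero_eq_one]
  exact h

lemma sum_traceChar_mul {c : k} (hc : c ≠ 0) : ∑ u : k, traceChar k (u * c) = 0 := by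
  have h : (traceChar k).IsPrimitive := fun a ha => by
    obtain ⟨u, hu⟩ := exists_traceChar_mul_ne_one ha
    exact AddChar.ne_one_iff.2 ⟨u, by simpa [AddChar.mulShift_apply] using hu⟩
  classical
  rw [AddChar.sum_mulShift c h, if_neg hc, Nat.cast_zero]

lemma psi_add (α β : Kinf k) : psi (α + β) = psi α * psi β := by
  simp only [psi_eq_traceChar, HahnSeries.coeff_add, AddChar.map_add_eq_mul]

lemma psi_eq_one {α : Kinf k} (h : α.coeff 1 = 0) : psi α = 1 := by
  rw [psi_eq_traceChar, h, AddChar.map_zero_eq_one]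

lemma psi_sum {ι : Type*} (s : Finset ι) (f : ι → Kinf k) :
    psi (∑ i ∈ s, f i) = ∏ i ∈ s, psi (f i) := by
  classical
  induction s using Finset.induction_on with
  | empty => simpa using psi_eq_one (k := k) (α := 0) rfl
  | insert i s hi ih => rw [Finset.sum_insert hi, Finset.prod_insert hi, psi_add, ih]

lemma norm_psi (α : Kinf k) : ‖psi α‖ = 1 := by
  rw [psi_eq_traceChar]; exact AddChar.norm_apply _ _

lemma isOpen_coeff_preimage {k : Type*} [Field k] (j : ℤ) (s : Set k) :
    IsOpen {α : Kinf k | α.coeff j ∈ s} := by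
  let _ : UniformSpace k := ⊥
  have _ : DiscreteTopology k := ⟨rfl⟩
  exact (isOpen_discrete s).preimage (LaurentSeries.uniformContinuous_coeff (K := k) j).continuous

lemma continuous_psi : Continuous (psi : Kinf k → ℂ) :=
  continuous_def.2 fun s _ => isOpen_coeff_preimage (k := k) 1 (traceChar k ⁻¹' s)

/-! ### The absolute value -/

lemma one_lt_card_real (k : Type*) [Field k] [Fintype k] : (1 : ℝ) < Fintype.card k := by
  exact_mod_cast Fintype.one_lt_card

lemma hat_lt_hat_iff {M N : ℝ} : hat k M < hat k N ↔ M < N :=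
  Real.rpow_lt_rpow_left_iff (one_lt_card_real k)

lemma hat_le_hat_iff {M N : ℝ} : hat k M ≤ hat k N ↔ M ≤ N :=
  Real.rpow_le_rpow_left_iff (one_lt_card_real k)

lemma hat_pos (M : ℝ) : 0 < hat k M :=
  Real.rpow_pos_of_pos (by linarith [one_lt_card_real k]) _

/-- The ball `|α| < q ^ (-m)` in `K_∞`. -/
def ball (k : Type*) [Field k] (m : ℤ) : Set (Kinf k) := {α | ∀ j ≤ m, α.coeff j = 0}

lemma mem_ball_iff_order {k : Type*} [Field k] {α : Kinf k} (hα : α ≠ 0) {m : ℤ} :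
    α ∈ ball k m ↔ m < α.order := by
  rw [← Int.add_one_le_iff, HahnSeries.le_order_iff_forall hα]
  exact ⟨fun h j hj => h j (by omega), fun h j hj => h j (by omega)⟩

lemma absK_lt_hat_iff (α : Kinf k) (m : ℤ) : absK α < hat k (-(m : ℝ)) ↔ α ∈ ball k m := by
  by_cases h : α = 0
  · simp [absK, h, hat_pos, ball]
  · rw [absK, if_neg h, hat_lt_hat_iff, neg_lt_neg_iff, Int.cast_lt, mem_ball_iff_order h]

lemma toKinf_C_mul_X_pow {k : Type*} [Field k] (c : k) (m : ℕ) :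
    toKinf k (C c * X ^ m) = HahnSeries.single (-(m : ℤ)) c := by
  simp [toKinf, HahnSeries.single_pow]

lemma coeff_toKinf {k : Type*} [Field k] (p : k[X]) (j : ℕ) :
    (toKinf k p).coeff (-(j : ℤ)) = p.coeff j := by
  induction p using Polynomial.induction_on' with
  | add p q hp hq => rw [map_add, HahnSeries.coeff_add, hp, hq, coeff_add]
  | monomial n a =>
    rw [← C_mul_X_pow_eq_monomial, toKinf_C_mul_X_pow, HahnSeries.coeff_single, coeff_C_mul_X_pow]
    simp

lemma coeff_toKinf_of_pos {k : Type*} [Field k] (p : k[X]) {j : ℤ} (hj : 0 < j) :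
    (toKinf k p).coeff j = 0 := by
  induction p using Polynomial.induction_on' with
  | add p q hp hq => rw [map_add, HahnSeries.coeff_add, hp, hq, add_zero]
  | monomial n a =>
    rw [← C_mul_X_pow_eq_monomial, toKinf_C_mul_X_pow, HahnSeries.coeff_single, if_neg (by omega)]

lemma psi_toKinf (p : k[X]) : psi (toKinf k p) = 1 :=
  psi_eq_one (coeff_toKinf_of_pos p one_pos)

lemma toKinf_ne_zero {k : Type*} [Field k] {p : k[X]} (hp : p ≠ 0) : toKinf k p ≠ 0 := fun h => by
  refine leadingCoeff_ne_zero.2 hp ?_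
  rw [leadingCoeff, ← coeff_toKinf, h, HahnSeries.coeff_zero]

lemma order_toKinf {k : Type*} [Field k] {p : k[X]} (hp : p ≠ 0) :
    (toKinf k p).order = -(p.natDegree : ℤ) := by
  apply le_antisymm
  · apply HahnSeries.order_le_of_coeff_ne_zero
    rw [coeff_toKinf]
    exact leadingCoeff_ne_zero.2 hp
  · rw [HahnSeries.le_order_iff_forall (toKinf_ne_zero hp)]
    intro j hj
    obtain ⟨i, rfl⟩ : ∃ i : ℕ, j = -(i : ℤ) := ⟨(-j).toNat, by omega⟩
    rw [coeff_toKinf]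
    exact coeff_eq_zero_of_natDegree_lt (by omega)

lemma absO_eq {p : k[X]} (hp : p ≠ 0) : absO p = (Fintype.card k : ℝ) ^ p.natDegree := by
  rw [absO, absK, if_neg (toKinf_ne_zero hp), order_toKinf hp, hat]
  simp

lemma absO_lt_absO_iff {p r : k[X]} (hr : r ≠ 0) : absO p < absO r ↔ p.degree < r.natDegree := by
  by_cases hp : p = 0
  · have h : (0 : ℝ) < (Fintype.card k : ℝ) ^ r.natDegree :=
      pow_pos (by linarith [one_lt_card_real k]) _
    rw [hp, degree_zero, absO_eq hr, absO, map_zero, absK, if_pos rfl]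
    exact iff_of_true h (WithBot.bot_lt_coe _)
  · rw [absO_eq hp, absO_eq hr, pow_lt_pow_iff_right₀ (one_lt_card_real k),
      degree_eq_natDegree hp, Nat.cast_lt]

/-! ### Haar measure of balls -/

instance : (haarK k).IsAddHaarMeasure := by unfold haarK; infer_instance

lemma unitT_eq_ball : unitT k = ball k 0 := by
  ext α
  rw [mem_unitT_iff]
  exact ⟨fun h j hj => h j (by omega), fun h j hj => h j (by omega)⟩

lemma isOpen_ball (m : ℤ) : IsOpen (ball k m) := by
  have h : ball k m = (fun α => HahnSeries.single (-m) (1 : k) * α) ⁻¹' unitT k := by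
    ext α
    rw [unitT_eq_ball]
    have h1 : ∀ j, (HahnSeries.single (-m) (1 : k) * α).coeff j = α.coeff (j + m) := fun j => by
      have := HahnSeries.coeff_single_mul_add (r := (1 : k)) (x := α) (a := j + m) (b := -m)
      simpa using this
    simp only [Set.mem_preimage, ball, Set.mem_ofPred_eq, h1]
    exact ⟨fun h j hj => h _ (by omega), fun h j hj => by simpa using h (j - m) (by omega)⟩
  rw [h]
  exact (isOpen_unitT k).preimage (by fun_prop)

lemma haarK_ball_succ (m : ℤ) :
    haarK k (ball k m) = Fintype.card k * haarK k (ball k (m + 1)) := by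
  have h : ball k m = ⋃ c : k,
      (fun α => HahnSeries.single (m + 1) (-c) + α) ⁻¹' ball k (m + 1) := by
    ext α
    simp only [ball, Set.mem_iUnion, Set.mem_preimage, Set.mem_ofPred_eq, HahnSeries.coeff_add,
      HahnSeries.coeff_single]
    constructor
    · intro h
      refine ⟨α.coeff (m + 1), fun j hj => ?_⟩
      split_ifs with h1
      · rw [h1, neg_add_cancel]
      · rw [h j (by omega), add_zero]
    · rintro ⟨c, hc⟩ j hj
      simpa [show j ≠ m + 1 by omega] using hc j (by omega)
  rw [h, measure_iUnion]
  · simp [measure_preimage_add]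
  · intro c d hcd
    refine Set.disjoint_left.2 fun α hc hd => hcd ?_
    have h1 := hc (m + 1) le_rfl
    have h2 := hd (m + 1) le_rfl
    simp only [HahnSeries.coeff_add, HahnSeries.coeff_single_same] at h1 h2
    rw [← neg_inj]
    exact add_right_cancel (h1.trans h2.symm)
  · exact fun c => ((isOpen_ball _).preimage (by fun_prop)).measurableSet

lemma haarK_ball (m : ℤ) :
    haarK k (ball k m) = ENNReal.ofReal ((Fintype.card k : ℝ) ^ (-m)) := by
  have hq := one_lt_card_real k
  have hq0 : (Fintype.card k : ℝ) ≠ 0 := by positivity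
  have key : ∀ m : ℤ, haarK k (ball k m) = ENNReal.ofReal ((Fintype.card k : ℝ) ^ (-m)) ↔
      haarK k (ball k (m + 1)) = ENNReal.ofReal ((Fintype.card k : ℝ) ^ (-(m + 1))) := by
    intro m
    have h1 : ENNReal.ofReal ((Fintype.card k : ℝ) ^ (-m)) = Fintype.card k *
        ENNReal.ofReal ((Fintype.card k : ℝ) ^ (-(m + 1))) := by
      rw [← ENNReal.ofReal_natCast, ← ENNReal.ofReal_mul (by positivity), ← zpow_one_add₀ hq0]
      congr 2; ring
    rw [haarK_ball_succ, h1]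
    exact ENNReal.mul_right_inj (by simp) (ENNReal.natCast_ne_top _)
  induction m using Int.induction_on with
  | zero =>
    rw [← unitT_eq_ball]
    rw [neg_zero, zpow_zero, ENNReal.ofReal_one]
    exact Measure.addHaarMeasure_self (K₀ := unitTCompacts k)
  | succ n ih => exact (key _).1 ih
  | pred n ih => exact (key _).2 (by simpa using ih)

lemma haarK_ball_lt_top (m : ℤ) : haarK k (ball k m) < ⊤ := by
  rw [haarK_ball]; exact ENNReal.ofReal_lt_top

lemma haarK_real_ball (m : ℤ) : (haarK k).real (ball k m) = (Fintype.card k : ℝ) ^ (-m) := by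
  rw [Measure.real, haarK_ball, ENNReal.toReal_ofReal (by positivity)]

instance : SigmaFinite (haarK k) := by
  refine ⟨⟨⟨fun i => ball k (-(i : ℤ)), fun _ => trivial, fun i => haarK_ball_lt_top _, ?_⟩⟩⟩
  refine Set.eq_univ_of_forall fun α => Set.mem_iUnion.2 ?_
  by_cases hα : α = 0
  · exact ⟨0, by simp [hα, ball]⟩
  · exact ⟨(1 - α.order).toNat, (mem_ball_iff_order hα).2 (by omega)⟩

/-! ### Cubic oscillatory integrals -/

lemma three_ne_zero_of_ringChar {k : Type*} [Field k] (hchar : 3 < ringChar k) : (3 : k) ≠ 0 := by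
  intro h
  have h1 : ringChar k ∣ 3 := (ringChar.spec k 3).1 (by exact_mod_cast h)
  exact absurd (Nat.le_of_dvd (by norm_num) h1) (by omega)

/-- A ball which does not contain `0` has `|x|` constant. -/
lemma order_eq_of_sub_mem_ball {k : Type*} [Field k] {x x₀ : Kinf k} {L : ℤ} (h₀ : x₀ ∉ ball k L)
    (hx : x - x₀ ∈ ball k L) : x ≠ 0 ∧ x.order = x₀.order ∧ x₀.order ≤ L := by
  have hx₀ : x₀ ≠ 0 := by rintro rfl; exact h₀ fun j _ => rfl
  have hL : x₀.order ≤ L := by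
    rw [mem_ball_iff_order hx₀] at h₀; omega
  have hc : ∀ j ≤ L, x.coeff j = x₀.coeff j := fun j hj => by
    have := hx j hj
    rwa [HahnSeries.coeff_sub, sub_eq_zero] at this
  have h1 : x.coeff x₀.order ≠ 0 := by
    rw [hc _ hL]; exact HahnSeries.coeff_order_eq_zero.not.2 hx₀
  have h2 : x ≠ 0 := by rintro rfl; exact h1 rfl
  refine ⟨h2, le_antisymm (HahnSeries.order_le_of_coeff_ne_zero h1) ?_, hL⟩
  rw [HahnSeries.le_order_iff_forall h2]
  intro j hj
  rw [hc _ (by omega)]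
  exact HahnSeries.coeff_eq_zero_of_lt_order hj

lemma coeff_mul_single {k : Type*} [Field k] (α : Kinf k) (c : k) (m j : ℤ) :
    (α * HahnSeries.single m c).coeff j = α.coeff (j - m) * c := by
  have := HahnSeries.coeff_mul_single_add (r := c) (x := α) (a := j - m) (b := m)
  rwa [sub_add_cancel] at this

/-- The phase `β x³` under the translation `x ↦ x + c t^{-m}`, at the scale where `ψ` sees only the
linear term: `m = 1 - ord β - 2 ord x`. -/
lemma psi_mul_add_single_cubed {β x : Kinf k} (hβ : β ≠ 0) (hx : x ≠ 0)
    (h : β.order ≤ -3 * x.order) (c : k) :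
    psi (β * (x + HahnSeries.single (1 - β.order - 2 * x.order) c) ^ 3) =
      psi (β * x ^ 3) * traceChar k (c * (3 * (β * x ^ 2).coeff (β * x ^ 2).order)) := by
  set m := 1 - β.order - 2 * x.order with hm
  have hx2 : (β * x ^ 2).order = β.order + 2 * x.order := by
    rw [HahnSeries.order_mul hβ (pow_ne_zero _ hx), HahnSeries.order_pow]; simp
  have hx1 : (β * x).order = β.order + x.order := HahnSeries.order_mul hβ hx
  have e : β * (x + HahnSeries.single m c) ^ 3 = β * x ^ 3 +
      (β * x ^ 2 * HahnSeries.single m (3 * c) + (β * x * HahnSeries.single (m + m) (3 * c * c)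
        + β * HahnSeries.single (m + m + m) (c * c * c))) := by
    have h3 : ∀ j (d : k), (HahnSeries.single j (3 * d) : Kinf k) = 3 * HahnSeries.single j d := by
      intro j d
      have : (3 : k) * d = d + d + d := by ring
      rw [this, HahnSeries.single_add, HahnSeries.single_add]; ring
    rw [mul_assoc (3 : k), h3, h3, ← HahnSeries.single_mul_single, ← HahnSeries.single_mul_single,
      ← HahnSeries.single_mul_single]
    ring
  rw [e, psi_add]
  congr 1
  rw [psi_eq_traceChar, HahnSeries.coeff_add, HahnSeries.coeff_add, coeff_mul_single,
    coeff_mul_single, coeff_mul_single]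
  have z1 : (β * x).coeff (1 - (m + m)) = 0 :=
    HahnSeries.coeff_eq_zero_of_lt_order (by rw [hx1]; omega)
  have z2 : β.coeff (1 - (m + m + m)) = 0 :=
    HahnSeries.coeff_eq_zero_of_lt_order (by omega)
  rw [z1, z2, zero_mul, zero_mul, add_zero, add_zero, hx2,
    show 1 - m = β.order + 2 * x.order by omega]
  congr 1; ring

lemma measurableSet_sub_mem_ball (x₀ : Kinf k) (L : ℤ) :
    MeasurableSet {x : Kinf k | x - x₀ ∈ ball k L} :=
  ((isOpen_ball L).preimage (f := fun x => x - x₀) (by fun_prop)).measurableSet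

lemma haarK_sub_mem_ball (x₀ : Kinf k) (L : ℤ) :
    haarK k {x : Kinf k | x - x₀ ∈ ball k L} = haarK k (ball k L) := by
  have := measure_preimage_add_right (haarK k) (-x₀) (ball k L)
  simp only [← sub_eq_add_neg] at this
  exact this

/-- The cubic phase `ψ(β x³)`, cut off to the ball `|x - x₀| < q ^ (-L)`. -/
noncomputable def cubicPhase (x₀ : Kinf k) (L : ℤ) (β : Kinf k) : Kinf k → ℂ :=
  Set.indicator {x | x - x₀ ∈ ball k L} fun x => psi (β * x ^ 3)

lemma integrable_cubicPhase (x₀ : Kinf k) (L : ℤ) (β : Kinf k) :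
    Integrable (cubicPhase x₀ L β) (haarK k) := by
  rw [cubicPhase, integrable_indicator_iff (measurableSet_sub_mem_ball x₀ L)]
  refine Measure.integrableOn_of_bounded (M := 1) ?_ ?_ ?_
  · rw [haarK_sub_mem_ball]; exact (haarK_ball_lt_top L).ne
  · exact (continuous_psi.comp (by fun_prop)).aestronglyMeasurable
  · exact Filter.Eventually.of_forall fun x => (norm_psi _).le

lemma norm_integral_cubicPhase_le (x₀ : Kinf k) {L : ℤ} (hL : 0 ≤ L) (β : Kinf k) :
    ‖∫ x, cubicPhase x₀ L β x ∂haarK k‖ ≤ 1 := by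
  rw [cubicPhase, integral_indicator (measurableSet_sub_mem_ball x₀ L)]
  refine (norm_setIntegral_le_of_norm_le_const (C := 1) ?_ fun x _ => (norm_psi _).le).trans ?_
  · rw [haarK_sub_mem_ball]; exact haarK_ball_lt_top L
  · rw [Measure.real, haarK_sub_mem_ball, one_mul]
    refine (haarK_real_ball (k := k) L).le.trans ?_
    exact zpow_le_one_of_nonpos₀ (one_lt_card_real k).le (by omega)

/-- Non-stationary phase: on a ball which avoids `0` the integral of `ψ(β x³)` vanishes as soon as
`β` is large. -/
lemma integral_cubicPhase_eq_zero (h3 : (3 : k) ≠ 0) {x₀ β : Kinf k} {L : ℤ} (hβ : β ≠ 0)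
    (h₀ : x₀ ∉ ball k L) (hord : β.order ≤ -3 * L) :
    ∫ x, cubicPhase x₀ L β x ∂haarK k = 0 := by
  set m := 1 - β.order - 2 * x₀.order with hm
  have hself : x₀ - x₀ ∈ ball k L := by rw [sub_self]; exact fun j _ => rfl
  have hL := (order_eq_of_sub_mem_ball h₀ hself).2.2
  have hmL : L < m := by omega
  -- The average of the translates by `c t^{-m}` vanishes identically.
  have key : ∀ x, ∑ c : k, cubicPhase x₀ L β (x + HahnSeries.single m c) = 0 := by
    intro x
    have hmem : ∀ c : k, x + HahnSeries.single m c - x₀ ∈ ball k L ↔ x - x₀ ∈ ball k L := by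
      intro c
      refine forall₂_congr fun j hj => ?_
      rw [add_sub_right_comm, HahnSeries.coeff_add, HahnSeries.coeff_single, if_neg (by omega),
        add_zero]
    by_cases hx : x - x₀ ∈ ball k L
    · obtain ⟨hx1, hx2, -⟩ := order_eq_of_sub_mem_ball h₀ hx
      have h2 : ∀ c : k, cubicPhase x₀ L β (x + HahnSeries.single m c) =
          psi (β * x ^ 3) * traceChar k (c * (3 * (β * x ^ 2).coeff (β * x ^ 2).order)) := by
        intro c
        rw [cubicPhase, Set.indicator_of_mem (show _ ∈ {y | y - x₀ ∈ ball k L} from (hmem c).2 hx),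
          hm, ← hx2]
        exact psi_mul_add_single_cubed hβ hx1 (by omega) c
      simp_rw [h2]
      rw [← Finset.mul_sum, sum_traceChar_mul, mul_zero]
      exact mul_ne_zero h3 (HahnSeries.coeff_order_eq_zero.not.2
        (mul_ne_zero hβ (pow_ne_zero _ hx1)))
    · refine Finset.sum_eq_zero fun c _ => ?_
      rw [cubicPhase, Set.indicator_of_notMem]
      exact fun h => hx ((hmem c).1 h)
  have h4 : (Fintype.card k : ℂ) * ∫ x, cubicPhase x₀ L β x ∂haarK k = 0 := by
    calc (Fintype.card k : ℂ) * ∫ x, cubicPhase x₀ L β x ∂haarK k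
        = ∑ c : k, ∫ x, cubicPhase x₀ L β (x + HahnSeries.single m c) ∂haarK k := by
          simp_rw [integral_add_right_eq_self (cubicPhase x₀ L β)]
          simp
      _ = ∫ x, ∑ c : k, cubicPhase x₀ L β (x + HahnSeries.single m c) ∂haarK k := by
          rw [integral_finsetSum]
          exact fun c _ => (integrable_cubicPhase x₀ L β).comp_add_right _
      _ = 0 := by simp_rw [key]; exact integral_zero _ _
  simpa using h4

/-! ### The integral attached to a diagonal cubic form -/

variable {n : ℕ}

lemma evalK_diagonalCubic {k : Type*} [Field k] (a : Fin n → kˣ) (x : Fin n → Kinf k) :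
    evalK (diagonalCubic a) x = ∑ i, toKinf k (C (a i : k)) * x i ^ 3 := by
  simp [evalK, diagonalCubic, MvPolynomial.eval₂_sum]

lemma det_hessian_diagonalCubic_eq_zero {k : Type*} [Field k] (a : Fin n → kˣ)
    {x : Fin n → Kinf k} {i : Fin n} (hi : x i = 0) : (hessian (diagonalCubic a) x).det = 0 := by
  refine Matrix.det_eq_zero_of_row_eq_zero i fun j => ?_
  have h1 : MvPolynomial.pderiv j (diagonalCubic a) =
      MvPolynomial.C (C (a j : k)) * (3 * MvPolynomial.X j ^ 2) := by
    rw [diagonalCubic, map_sum, Finset.sum_eq_single j]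
    · rw [MvPolynomial.pderiv_C_mul, MvPolynomial.pderiv_pow, MvPolynomial.pderiv_X_self]
      simp
    · intro b _ hb
      rw [MvPolynomial.pderiv_C_mul, MvPolynomial.pderiv_pow, MvPolynomial.pderiv_X_of_ne hb]
      simp
    · simp
  have h2 : MvPolynomial.pderiv i (MvPolynomial.pderiv j (diagonalCubic a)) =
      MvPolynomial.X i * (MvPolynomial.C (C (a j : k)) * (3 * (2 *
        MvPolynomial.pderiv i (MvPolynomial.X j)))) := by
    rw [h1]
    have h3 : (3 : MvPolynomial (Fin n) k[X]) = MvPolynomial.C 3 := (map_ofNat _ 3).symm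
    rw [MvPolynomial.pderiv_C_mul, h3, MvPolynomial.pderiv_C_mul, MvPolynomial.pderiv_pow]
    by_cases hij : j = i
    · subst hij; push_cast; ring
    · rw [MvPolynomial.pderiv_X_of_ne hij]; ring
  rw [hessian, Matrix.of_apply, h2, evalK, MvPolynomial.eval₂_mul, MvPolynomial.eval₂_X, hi,
    zero_mul]

/-- The weight function is the indicator of a box no side of which contains `0`, because the Hessian
determinant `∏ᵢ 6 aᵢ xᵢ` vanishes wherever a coordinate does. -/
lemma IsWeight.exists_box {a : Fin n → kˣ} {w : (Fin n → Kinf k) → ℝ}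
    (hw : IsWeight (diagonalCubic a) w) : ∃ (x₀ : Fin n → Kinf k) (L : ℕ),
      (∀ i, x₀ i ∉ ball k L) ∧
      w = Set.indicator {x | ∀ i, x i - x₀ i ∈ ball k L} 1 := by
  obtain ⟨x₀, L, -, h2⟩ := hw.eq_indicator
  have h3 : w = Set.indicator {x | ∀ i, x i - x₀ i ∈ ball k L} 1 := by
    rw [h2]; congr 1; ext x
    refine forall_congr' fun i => ?_
    rw [← absK_lt_hat_iff, Int.cast_natCast]
  refine ⟨x₀, L, fun i hi => ?_, h3⟩
  refine hw.det_hessian_ne_zero (Function.update x₀ i 0) ?_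
    (det_hessian_diagonalCubic_eq_zero a (Function.update_self i 0 x₀))
  rw [h3, Function.mem_support, Set.indicator_of_mem]
  · simp
  · intro j
    by_cases hj : j = i
    · subst hj
      intro l hl
      rw [Function.update_self, HahnSeries.coeff_sub, hi l hl, HahnSeries.coeff_zero, sub_zero]
    · rw [Function.update_of_ne hj, sub_self]
      exact fun l _ => rfl

lemma oscInt_diagonalCubic (a : Fin n → kˣ) (x₀ : Fin n → Kinf k) (L : ℤ) (P r : k[X])
    (θ : Kinf k) :
    oscInt (diagonalCubic a) (Set.indicator {x | ∀ i, x i - x₀ i ∈ ball k L} 1) P r θ 0 =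
      ∏ i, ∫ x, cubicPhase (x₀ i) L (θ * toKinf k P ^ 3 * toKinf k (C (a i : k))) x ∂haarK k := by
  rw [oscInt, haarKn, ← integral_fintype_prod_eq_prod]
  congr 1
  funext x
  have h0 : θ * toKinf k P ^ 3 * evalK (diagonalCubic a) x
      + toKinf k P * (∑ i, toKinf k ((0 : Fin n → k[X]) i) * x i) / toKinf k r
      = ∑ i, θ * toKinf k P ^ 3 * toKinf k (C (a i : k)) * x i ^ 3 := by
    simp only [Pi.zero_apply, map_zero, zero_mul, Finset.sum_const_zero, mul_zero, zero_div,
      add_zero, evalK_diagonalCubic, Finset.mul_sum, mul_assoc]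
  rw [h0, psi_sum]
  by_cases hx : ∀ i, x i - x₀ i ∈ ball k L
  · rw [Set.indicator_of_mem (show x ∈ {x | ∀ i, x i - x₀ i ∈ ball k L} from hx)]
    simp only [Pi.one_apply, Complex.ofReal_one, one_mul]
    refine Finset.prod_congr rfl fun i _ => ?_
    rw [cubicPhase, Set.indicator_of_mem (show x i ∈ {y | y - x₀ i ∈ ball k L} from hx i)]
  · rw [Set.indicator_of_notMem (show x ∉ {x | ∀ i, x i - x₀ i ∈ ball k L} from hx)]
    push Not at hx
    obtain ⟨i, hi⟩ := hx
    rw [Complex.ofReal_zero, zero_mul, eq_comm]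
    refine Finset.prod_eq_zero (Finset.mem_univ i) ?_
    rw [cubicPhase, Set.indicator_of_notMem (show x i ∉ {y | y - x₀ i ∈ ball k L} from hi)]

lemma order_mul_toKinf_C {k : Type*} [Field k] {β : Kinf k} (hβ : β ≠ 0) (c : kˣ) :
    (β * toKinf k (C (c : k))).order = β.order := by
  rw [HahnSeries.order_mul hβ (toKinf_ne_zero (C_ne_zero.2 c.ne_zero)),
    order_toKinf (C_ne_zero.2 c.ne_zero)]
  simp

/-- The average integral has size `O(|P|⁻³)`, uniformly in `r` and `Q`: the integral over `𝐱` is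
bounded by `1` and vanishes unless `|θ P³|` is bounded. -/
lemma exists_norm_avgInt_le (h3 : (3 : k) ≠ 0) (hn : 0 < n) (a : Fin n → kˣ)
    {w : (Fin n → Kinf k) → ℝ} (hw : IsWeight (diagonalCubic a) w) :
    ∃ B : ℝ, 0 < B ∧ ∀ P : k[X], P ≠ 0 → ∀ (r : k[X]) (Q : ℝ),
      ‖avgInt (diagonalCubic a) w P r Q 0‖ ≤ B * (absO P ^ 3)⁻¹ := by
  obtain ⟨x₀, L, h₀, rfl⟩ := hw.exists_box
  have hq := one_lt_card_real k
  have hq0 : (Fintype.card k : ℝ) ≠ 0 := by positivity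
  refine ⟨(Fintype.card k : ℝ) ^ (3 * L), by positivity, fun P hP r Q => ?_⟩
  have hP' := toKinf_ne_zero hP
  set m : ℤ := -3 * L + 3 * P.natDegree with hm
  -- `θ ∈ ball k m` means `|θ P³| < q ^ (3 L)`.
  have hbound : ∀ θ : Kinf k, ‖oscInt (diagonalCubic a)
      (Set.indicator {x | ∀ i, x i - x₀ i ∈ ball k L} 1) P r θ 0‖ ≤
        Set.indicator (ball k m) (fun _ => (1 : ℝ)) θ := by
    intro θ
    rw [oscInt_diagonalCubic, norm_prod]
    by_cases hθ : θ ∈ ball k m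
    · rw [Set.indicator_of_mem hθ]
      exact Finset.prod_le_one (fun i _ => norm_nonneg _)
        fun i _ => norm_integral_cubicPhase_le _ (by positivity) _
    · have hθ0 : θ ≠ 0 := by rintro rfl; exact hθ fun j _ => rfl
      have hβ : θ * toKinf k P ^ 3 ≠ 0 := mul_ne_zero hθ0 (pow_ne_zero _ hP')
      have hord : (θ * toKinf k P ^ 3).order = θ.order - 3 * P.natDegree := by
        rw [HahnSeries.order_mul hθ0 (pow_ne_zero _ hP'), HahnSeries.order_pow, order_toKinf hP]
        simp; ring
      rw [mem_ball_iff_order hθ0] at hθ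
      rw [Set.indicator_of_notMem (by rwa [mem_ball_iff_order hθ0]),
        Finset.prod_eq_zero (Finset.mem_univ ⟨0, hn⟩)]
      rw [integral_cubicPhase_eq_zero h3 _ (h₀ _), norm_zero]
      · rw [order_mul_toKinf_C hβ, hord]; omega
      · exact mul_ne_zero hβ (toKinf_ne_zero (C_ne_zero.2 (Units.ne_zero _)))
  have hint : Integrable (Set.indicator (ball k m) fun _ => (1 : ℝ)) (haarK k) := by
    rw [integrable_indicator_iff (isOpen_ball m).measurableSet]
    exact integrableOn_const (haarK_ball_lt_top m).ne
  calc ‖avgInt (diagonalCubic a) _ P r Q 0‖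
      ≤ ∫ θ in {θ : Kinf k | absK θ < (absO r)⁻¹ * (hat k Q)⁻¹},
          Set.indicator (ball k m) (fun _ => (1 : ℝ)) θ ∂haarK k :=
        norm_integral_le_of_norm_le hint.integrableOn (Filter.Eventually.of_forall hbound)
    _ ≤ ∫ θ, Set.indicator (ball k m) (fun _ => (1 : ℝ)) θ ∂haarK k :=
        setIntegral_le_integral hint
          (Filter.Eventually.of_forall fun θ => Set.indicator_nonneg (fun _ _ => zero_le_one) θ)
    _ = (Fintype.card k : ℝ) ^ (-m) := by
        rw [integral_indicator (isOpen_ball m).measurableSet]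
        simp [haarK_real_ball]
    _ = (Fintype.card k : ℝ) ^ (3 * L) * (absO P ^ 3)⁻¹ := by
        rw [absO_eq hP, ← pow_mul, hm, neg_add, zpow_add₀ hq0, zpow_neg _ (3 * (P.natDegree : ℤ))]
        congr 1
        · rw [← zpow_natCast]; congr 1; push_cast; ring
        · congr 1; rw [← zpow_natCast]; congr 1; push_cast; ring

/-! ### Cubic sums over a finite field -/

lemma card_filter_cube_eq_le {F : Type*} [Field F] [Fintype F] [DecidableEq F] (c : F) :
    (Finset.univ.filter fun x : F => x ^ 3 = c).card ≤ 3 := by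
  refine le_trans (Finset.card_le_card fun x hx => ?_)
    ((Multiset.toFinset_card_le _).trans (card_nthRoots 3 c))
  rw [Multiset.mem_toFinset, mem_nthRoots (by norm_num)]
  exact (Finset.mem_filter.1 hx).2

/-- The mean square of `b ↦ ∑ₓ χ(b x³)`, where each cube has at most three cube roots. -/
lemma sum_sq_norm_cubicSum_le {F : Type*} [Field F] [Fintype F] {χ : AddChar F ℂ}
    (hχ : χ.IsPrimitive) :
    ∑ b : F, ‖∑ x : F, χ (b * x ^ 3)‖ ^ 2 ≤ 3 * (Fintype.card F : ℝ) ^ 2 := by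
  classical
  have h1 : ((∑ b : F, ‖∑ x : F, χ (b * x ^ 3)‖ ^ 2 : ℝ) : ℂ) =
      ((Fintype.card F *
        ∑ y : F, (Finset.univ.filter fun x : F => x ^ 3 = y ^ 3).card : ℕ) : ℂ) := by
    push_cast
    calc ∑ b : F, (‖∑ x : F, χ (b * x ^ 3)‖ : ℂ) ^ 2
        = ∑ b : F, ∑ y : F, ∑ x : F, χ (b * (x ^ 3 - y ^ 3)) := by
          refine Finset.sum_congr rfl fun b _ => ?_
          rw [← Complex.mul_conj', map_sum, Finset.sum_mul_sum, Finset.sum_comm]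
          refine Finset.sum_congr rfl fun y _ => Finset.sum_congr rfl fun x _ => ?_
          rw [mul_sub, sub_eq_add_neg, AddChar.map_add_eq_mul, AddChar.map_neg_eq_conj]
      _ = ∑ y : F, ∑ x : F, ∑ b : F, χ (b * (x ^ 3 - y ^ 3)) := by
          rw [Finset.sum_comm]
          exact Finset.sum_congr rfl fun y _ => Finset.sum_comm
      _ = _ := by
          rw [Finset.mul_sum]
          refine Finset.sum_congr rfl fun y _ => ?_
          simp_rw [AddChar.sum_mulShift _ hχ, sub_eq_zero]
          rw [Finset.sum_congr rfl fun x _ => Nat.cast_ite (x ^ 3 = y ^ 3) (Fintype.card F) 0,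
            Finset.sum_ite]
          simp [mul_comm]
  have h2 : (∑ b : F, ‖∑ x : F, χ (b * x ^ 3)‖ ^ 2 : ℝ) =
      ((Fintype.card F *
        ∑ y : F, (Finset.univ.filter fun x : F => x ^ 3 = y ^ 3).card : ℕ) : ℝ) := by
    exact_mod_cast h1
  rw [h2]
  have h3 : ∑ y : F, (Finset.univ.filter fun x : F => x ^ 3 = y ^ 3).card ≤ Fintype.card F * 3 := by
    refine (Finset.sum_le_card_nsmul _ _ 3 fun y _ => card_filter_cube_eq_le _).trans ?_
    simp
  have h4 : (Fintype.card F * ∑ y : F, (Finset.univ.filter fun x : F => x ^ 3 = y ^ 3).card)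
      ≤ 3 * Fintype.card F ^ 2 := (Nat.mul_le_mul_left _ h3).trans (by rw [sq]; linarith)
  exact_mod_cast h4

/-- Square-root cancellation in complete cubic sums. As `∑ₓ χ(b x³)` depends only on the class of
`b ≠ 0` modulo cubes, one large value would make the mean square too large. -/
lemma sq_norm_cubicSum_field_le {F : Type*} [Field F] [Fintype F] {χ : AddChar F ℂ}
    (hχ : χ.IsPrimitive) : ‖∑ x : F, χ (x ^ 3)‖ ^ 2 ≤ 18 * (Fintype.card F : ℝ) := by
  classical
  set G : F → ℝ := fun b => ‖∑ x : F, χ (b * x ^ 3)‖ ^ 2 with hG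
  have hG0 : ∀ b, 0 ≤ G b := fun b => sq_nonneg _
  have h1 : ∀ u : F, u ≠ 0 → G (u ^ 3) = G 1 := by
    intro u hu
    simp only [hG, one_mul]
    congr 2
    refine Fintype.sum_equiv (Equiv.mulLeft₀ u hu) _ _ fun x => ?_
    rw [← mul_pow]; rfl
  have h2 : ((Fintype.card F : ℝ) - 1) * G 1 ≤ ∑ u : F, G (u ^ 3) := by
    calc ((Fintype.card F : ℝ) - 1) * G 1 = ∑ u ∈ Finset.univ.erase (0 : F), G (u ^ 3) := by
          rw [Finset.sum_congr rfl fun u hu => h1 u (Finset.ne_of_mem_erase hu), Finset.sum_const,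
            Finset.card_erase_of_mem (Finset.mem_univ _), Finset.card_univ, nsmul_eq_mul,
            Nat.cast_sub Fintype.card_pos, Nat.cast_one]
      _ ≤ _ := Finset.sum_le_sum_of_subset_of_nonneg (Finset.erase_subset _ _) fun _ _ _ => hG0 _
  have h3 : ∑ u : F, G (u ^ 3) ≤ 3 * ∑ b : F, G b := by
    rw [← Finset.sum_fiberwise Finset.univ (fun u : F => u ^ 3), Finset.mul_sum]
    refine Finset.sum_le_sum fun b _ => ?_
    rw [Finset.sum_congr rfl fun u hu => congrArg G (Finset.mem_filter.1 hu).2, Finset.sum_const,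
      nsmul_eq_mul]
    exact mul_le_mul_of_nonneg_right (by exact_mod_cast card_filter_cube_eq_le b) (hG0 b)
  have h4 := sum_sq_norm_cubicSum_le hχ
  have hN : (2 : ℝ) ≤ Fintype.card F := by exact_mod_cast Fintype.one_lt_card
  have h5 : ‖∑ x : F, χ (x ^ 3)‖ ^ 2 = G 1 := by simp [hG]
  rw [h5]
  have h6 : ((Fintype.card F : ℝ) - 1) * G 1 ≤ 9 * (Fintype.card F : ℝ) ^ 2 := by
    simp only [hG] at h2 h3 ⊢
    linarith
  by_contra! h7
  nlinarith [mul_lt_mul_of_pos_left h7 (by linarith : (0 : ℝ) < (Fintype.card F : ℝ) - 1)]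

/-! ### Polynomials of bounded degree -/

/-- The finite set of polynomials of degree less than `d`. -/
noncomputable def polyLT (k : Type*) [Field k] [Fintype k] (d : ℕ) : Finset k[X] :=
  haveI : Finite (degreeLT k d) := Finite.of_equiv _ (degreeLTEquiv k d).symm.toEquiv
  (Set.toFinite (degreeLT k d : Set k[X])).toFinset

lemma mem_polyLT {d : ℕ} {p : k[X]} : p ∈ polyLT k d ↔ p.degree < d := by
  simp [polyLT, mem_degreeLT]

lemma card_polyLT (d : ℕ) : (polyLT k d).card = Fintype.card k ^ d := by
  have h := Nat.card_congr (degreeLTEquiv k d).toEquiv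
  rw [Nat.card_fun, Nat.card_eq_fintype_card (α := k), Nat.card_eq_fintype_card (α := Fin d),
    Fintype.card_fin] at h
  have _ : Finite (degreeLT k d) := Finite.of_equiv _ (degreeLTEquiv k d).symm.toEquiv
  rw [← h, polyLT, ← Set.ncard_eq_toFinset_card (degreeLT k d : Set k[X]) (Set.toFinite _)]
  rfl

lemma zero_mem_polyLT (d : ℕ) : (0 : k[X]) ∈ polyLT k d :=
  mem_polyLT.2 (by simp)

lemma eq_zero_of_dvd_of_mem_polyLT {r x : k[X]} (h : r ∣ x) (hx : x ∈ polyLT k r.natDegree) :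
    x = 0 := by
  by_cases hr : r = 0
  · rw [hr, zero_dvd_iff] at h; exact h
  · refine eq_zero_of_dvd_of_degree_lt h ?_
    rw [degree_eq_natDegree hr]; exact mem_polyLT.1 hx

lemma modByMonic_mem_polyLT {s : k[X]} (hs : s.Monic) (x : k[X]) :
    x %ₘ s ∈ polyLT k s.natDegree := by
  rw [mem_polyLT, ← degree_eq_natDegree hs.ne_zero]
  exact degree_modByMonic_lt x hs

lemma add_mul_mem_polyLT {s y z : k[X]} {d : ℕ} (hy : y ∈ polyLT k s.natDegree)
    (hz : z ∈ polyLT k d) : y + s * z ∈ polyLT k (s.natDegree + d) := by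
  rw [mem_polyLT] at *
  refine lt_of_le_of_lt (degree_add_le _ _) (max_lt (hy.trans_le ?_) ?_)
  · exact_mod_cast Nat.le_add_right _ _
  · by_cases hz0 : z = 0
    · simp only [hz0, mul_zero, degree_zero]; exact WithBot.bot_lt_coe _
    · by_cases hs0 : s = 0
      · simp only [hs0, zero_mul, degree_zero]; exact WithBot.bot_lt_coe _
      rw [degree_mul, degree_eq_natDegree hs0, degree_eq_natDegree hz0] at *
      have : z.natDegree < d := by exact_mod_cast hz
      exact_mod_cast Nat.add_lt_add_left this _

/-- Division with remainder, as an identity between sums. -/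
lemma sum_polyLT_add {s : k[X]} (hs : s.Monic) (d : ℕ) (f : k[X] → ℂ) :
    ∑ x ∈ polyLT k (s.natDegree + d), f x =
      ∑ y ∈ polyLT k s.natDegree, ∑ z ∈ polyLT k d, f (y + s * z) := by
  classical
  have hinj : Set.InjOn (fun p : k[X] × k[X] => p.1 + s * p.2)
      (polyLT k s.natDegree ×ˢ polyLT k d : Finset _) := by
    rintro ⟨y, z⟩ h1 ⟨y', z'⟩ h2 h
    simp only [Finset.coe_product, Set.mem_prod, Finset.mem_coe, mem_polyLT,
      ← degree_eq_natDegree hs.ne_zero] at h1 h2 h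
    have e1 := div_modByMonic_unique z y hs ⟨rfl, h1.1⟩
    have e2 := div_modByMonic_unique z' y' hs ⟨h.symm, h2.1⟩
    rw [Prod.mk.injEq]
    exact ⟨e1.2.symm.trans e2.2, e1.1.symm.trans e2.1⟩
  rw [← Finset.sum_product', ← Finset.sum_image (g := fun p : k[X] × k[X] => p.1 + s * p.2) hinj]
  refine Finset.sum_congr (Finset.eq_of_subset_of_card_le ?_ ?_).symm fun _ _ => rfl
  · intro x hx
    obtain ⟨⟨y, z⟩, h, rfl⟩ := Finset.mem_image.1 hx
    rw [Finset.mem_product] at h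
    exact add_mul_mem_polyLT h.1 h.2
  · rw [Finset.card_image_of_injOn hinj, Finset.card_product, card_polyLT, card_polyLT, card_polyLT,
      pow_add]

/-- The Chinese remainder theorem, as an identity between sums. -/
lemma sum_polyLT_coprime {r s : k[X]} (hr : r ≠ 0) (hs : s ≠ 0) (h : IsCoprime r s)
    (f : k[X] → ℂ) : ∑ x ∈ polyLT k (r * s).natDegree, f x =
      ∑ y ∈ polyLT k r.natDegree, ∑ z ∈ polyLT k s.natDegree, f (s * y + r * z) := by
  classical
  have hinj : Set.InjOn (fun p : k[X] × k[X] => s * p.1 + r * p.2)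
      (polyLT k r.natDegree ×ˢ polyLT k s.natDegree : Finset _) := by
    rintro ⟨y, z⟩ h1 ⟨y', z'⟩ h2 he
    simp only [Finset.coe_product, Set.mem_prod, Finset.mem_coe] at h1 h2 he
    have hy : r ∣ y - y' := h.dvd_of_dvd_mul_left ⟨z' - z, by linear_combination he⟩
    have hz : s ∣ z - z' := h.symm.dvd_of_dvd_mul_left ⟨y' - y, by linear_combination he⟩
    have sub_mem : ∀ {d : ℕ} {a b : k[X]}, a ∈ polyLT k d → b ∈ polyLT k d →
        a - b ∈ polyLT k d := fun ha hb => by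
      rw [mem_polyLT] at *; exact (degree_sub_le _ _).trans_lt (max_lt ha hb)
    rw [Prod.mk.injEq, ← sub_eq_zero, ← sub_eq_zero (a := z)]
    exact ⟨eq_zero_of_dvd_of_mem_polyLT hy (sub_mem h1.1 h2.1),
      eq_zero_of_dvd_of_mem_polyLT hz (sub_mem h1.2 h2.2)⟩
  rw [← Finset.sum_product', ← Finset.sum_image
    (g := fun p : k[X] × k[X] => s * p.1 + r * p.2) hinj]
  refine Finset.sum_congr (Finset.eq_of_subset_of_card_le ?_ ?_).symm fun _ _ => rfl
  · intro x hx
    obtain ⟨⟨y, z⟩, h, rfl⟩ := Finset.mem_image.1 hx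
    rw [Finset.mem_product] at h
    have h1 := add_mul_mem_polyLT (zero_mem_polyLT s.natDegree) h.1
    have h2 := add_mul_mem_polyLT (zero_mem_polyLT r.natDegree) h.2
    rw [zero_add, mem_polyLT] at h1 h2
    rw [natDegree_mul hr hs, mem_polyLT]
    rw [add_comm] at h1
    exact (degree_add_le _ _).trans_lt (max_lt h1 h2)
  · rw [Finset.card_image_of_injOn hinj, Finset.card_product, card_polyLT, card_polyLT, card_polyLT,
      natDegree_mul hr hs, pow_add]

/-! ### Additive characters of `𝔽_q[t]` -/

/-- The character `φ` of `𝔽_q[t]` has level `r` if `(r)` is the largest ideal in its kernel, that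
is, if `φ` induces a primitive character modulo `r`. -/
def HasLevel {k : Type*} [Field k] (φ : AddChar k[X] ℂ) (r : k[X]) : Prop :=
  ∀ y, (∀ x, φ (x * y) = 1) ↔ r ∣ y

lemma norm_addChar_polynomial (φ : AddChar k[X] ℂ) (x : k[X]) : ‖φ x‖ = 1 := by
  have h : φ x ^ ringChar k = 1 := by
    rw [← AddChar.map_nsmul_eq_pow, nsmul_eq_mul]
    have : ((ringChar k : ℕ) : k[X]) = 0 := by
      rw [← C_eq_natCast, CharP.cast_eq_zero, C_0]
    rw [this, zero_mul, AddChar.map_zero_eq_one]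
  exact Complex.norm_eq_one_of_pow_eq_one h (CharP.ringChar_ne_zero_of_finite k)

namespace HasLevel

variable {k : Type*} [Field k] {φ : AddChar k[X] ℂ} {r : k[X]}

lemma apply_eq_one (h : HasLevel φ r) {x : k[X]} (hx : r ∣ x) : φ x = 1 := by
  simpa using (h x).2 hx 1

lemma apply_congr (h : HasLevel φ r) {x y : k[X]} (hxy : r ∣ x - y) : φ x = φ y := by
  rw [← sub_add_cancel x y, AddChar.map_add_eq_mul, h.apply_eq_one hxy, one_mul]

lemma mulShift_of_isCoprime (h : HasLevel φ r) {b : k[X]} (hb : IsCoprime b r) :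
    HasLevel (φ.mulShift b) r := fun y => by
  have : (∀ x, φ.mulShift b (x * y) = 1) ↔ ∀ x, φ (x * (b * y)) = 1 := by
    simp only [AddChar.mulShift_apply]
    exact forall_congr' fun x => by rw [mul_left_comm]
  rw [this, h]
  exact ⟨hb.symm.dvd_of_dvd_mul_left, fun h => h.mul_left b⟩

lemma mulShift_of_mul {b : k[X]} (hb : b ≠ 0) (h : HasLevel φ (b * r)) :
    HasLevel (φ.mulShift b) r := fun y => by
  have : (∀ x, φ.mulShift b (x * y) = 1) ↔ ∀ x, φ (x * (b * y)) = 1 := by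
    simp only [AddChar.mulShift_apply]
    exact forall_congr' fun x => by rw [mul_left_comm]
  rw [this, h, mul_dvd_mul_iff_left hb]

end HasLevel

lemma HasLevel.sum_mul_eq_zero {φ : AddChar k[X] ℂ} {r : k[X]} (h : HasLevel φ r) (hr : r.Monic)
    {c : k[X]} (hc : ¬ r ∣ c) : ∑ z ∈ polyLT k r.natDegree, φ (c * z) = 0 := by
  rw [← h] at hc
  push Not at hc
  obtain ⟨x, hx⟩ := hc
  have h0 : φ (c * (x %ₘ r)) ≠ 1 := by
    rwa [h.apply_congr (x := c * (x %ₘ r)) (y := x * c)]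
    refine ⟨-(c * (x /ₘ r)), ?_⟩
    linear_combination c * modByMonic_add_div x r
  have hm := mem_polyLT.1 (modByMonic_mem_polyLT hr x)
  refine eq_zero_of_mul_eq_self_left h0 ?_
  rw [Finset.mul_sum]
  refine Finset.sum_nbij' (fun z => x %ₘ r + z) (fun z => z - x %ₘ r) ?_ ?_ ?_ ?_ ?_
  · exact fun z hz => mem_polyLT.2 ((degree_add_le _ _).trans_lt (max_lt hm (mem_polyLT.1 hz)))
  · exact fun z hz => mem_polyLT.2 ((degree_sub_le _ _).trans_lt (max_lt (mem_polyLT.1 hz) hm))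
  · exact fun z _ => add_sub_cancel_left _ _
  · exact fun z _ => add_sub_cancel _ _
  · exact fun z _ => by rw [mul_add, AddChar.map_add_eq_mul]

/-! ### Complete cubic sums over `𝔽_q[t]` -/

/-- The sum of `φ(x³)` over the polynomials of degree less than `d`. -/
noncomputable def cubicSum (φ : AddChar k[X] ℂ) (d : ℕ) : ℂ := ∑ x ∈ polyLT k d, φ (x ^ 3)

lemma norm_cubicSum_le (φ : AddChar k[X] ℂ) (d : ℕ) :
    ‖cubicSum φ d‖ ≤ (Fintype.card k : ℝ) ^ d := by
  refine (norm_sum_le _ _).trans ?_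
  rw [Finset.sum_congr rfl fun x _ => norm_addChar_polynomial φ (x ^ 3)]
  simp [card_polyLT]

lemma cubicSum_mul {φ : AddChar k[X] ℂ} {r s : k[X]} (hr : r ≠ 0) (hs : s ≠ 0)
    (h : IsCoprime r s) (hφ : HasLevel φ (r * s)) :
    cubicSum φ (r * s).natDegree = cubicSum ((φ.mulShift s).mulShift (s ^ 2)) r.natDegree *
      cubicSum ((φ.mulShift r).mulShift (r ^ 2)) s.natDegree := by
  rw [cubicSum, sum_polyLT_coprime hr hs h, cubicSum, cubicSum, Finset.sum_mul_sum]
  refine Finset.sum_congr rfl fun y _ => Finset.sum_congr rfl fun z _ => ?_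
  simp only [AddChar.mulShift_apply]
  rw [← AddChar.map_add_eq_mul]
  refine hφ.apply_congr ⟨3 * s * y ^ 2 * z + 3 * r * y * z ^ 2, ?_⟩
  ring

/-- Modulo a prime power `π ^ m` with `m ≥ 2`, only the multiples of `π` contribute. -/
lemma cubicSum_prime_pow (h3 : (3 : k) ≠ 0) {φ : AddChar k[X] ℂ} {p : k[X]} (hp : p.Monic)
    (hirr : Irreducible p) (m : ℕ) (hφ : HasLevel φ (p ^ (m + 2))) :
    cubicSum φ (p ^ (m + 2)).natDegree = (Fintype.card k : ℂ) ^ p.natDegree *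
      ∑ u ∈ polyLT k (m * p.natDegree), φ ((p * u) ^ 3) := by
  classical
  have hpm : (p ^ (m + 1)).Monic := hp.pow _
  have hlev : HasLevel (φ.mulShift (p ^ (m + 1))) p :=
    HasLevel.mulShift_of_mul hpm.ne_zero (by rwa [← pow_succ])
  have h3' : ¬ p ∣ (3 : k[X]) := by
    have : (3 : k[X]) = C 3 := (map_ofNat C 3).symm
    rw [this]
    exact fun h => hirr.not_isUnit (isUnit_of_dvd_unit h (isUnit_C.2 (isUnit_iff_ne_zero.2 h3)))
  have hprime := hirr.prime
  -- Write `x = y + π ^ (m + 1) z`: the phase is linear in `z`, with slope `3 y²`.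
  have inner : ∀ y : k[X], ∑ z ∈ polyLT k p.natDegree, φ ((y + p ^ (m + 1) * z) ^ 3) =
      if p ∣ y then (Fintype.card k : ℂ) ^ p.natDegree * φ (y ^ 3) else 0 := by
    intro y
    have e : ∀ z, φ ((y + p ^ (m + 1) * z) ^ 3) =
        φ (y ^ 3) * φ.mulShift (p ^ (m + 1)) (3 * y ^ 2 * z) := by
      intro z
      rw [AddChar.mulShift_apply, ← AddChar.map_add_eq_mul]
      refine hφ.apply_congr ⟨3 * y * p ^ m * z ^ 2 + p ^ (2 * m + 1) * z ^ 3, ?_⟩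
      ring
    simp_rw [e]
    rw [← Finset.mul_sum]
    split_ifs with hy
    · rw [Finset.sum_congr rfl fun z _ => hlev.apply_eq_one
        (((hy.trans (dvd_pow_self y two_ne_zero)).mul_left 3).mul_right z)]
      simp [card_polyLT, mul_comm]
    · rw [hlev.sum_mul_eq_zero hp, mul_zero]
      intro h
      rcases hprime.dvd_or_dvd h with h | h
      · exact h3' h
      · exact hy (hprime.dvd_of_dvd_pow h)
  have hdeg : (p ^ (m + 2)).natDegree = (p ^ (m + 1)).natDegree + p.natDegree := by
    rw [hp.natDegree_pow, hp.natDegree_pow]; ring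
  have hdeg' : (p ^ (m + 1)).natDegree = p.natDegree + m * p.natDegree := by
    rw [hp.natDegree_pow]; ring
  rw [cubicSum, hdeg, sum_polyLT_add hpm, Finset.sum_congr rfl fun y _ => inner y, hdeg',
    sum_polyLT_add hp, Finset.sum_eq_single 0]
  · rw [Finset.mul_sum]
    refine Finset.sum_congr rfl fun u _ => ?_
    rw [zero_add, if_pos (dvd_mul_right p u)]
  · intro y hy hy0
    refine Finset.sum_eq_zero fun u _ => if_neg fun h => hy0 ?_
    exact eq_zero_of_dvd_of_mem_polyLT ((dvd_add_left (dvd_mul_right p u)).1 h) hy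
  · exact fun h => absurd (zero_mem_polyLT _) h

lemma norm_cubicSum_prime_sq_le (h3 : (3 : k) ≠ 0) {φ : AddChar k[X] ℂ} {p : k[X]} (hp : p.Monic)
    (hirr : Irreducible p) (hφ : HasLevel φ (p ^ 2)) :
    ‖cubicSum φ (p ^ 2).natDegree‖ ≤ (Fintype.card k : ℝ) ^ p.natDegree := by
  have h := cubicSum_prime_pow h3 hp hirr 0 (φ := φ) hφ
  rw [zero_add, zero_mul] at h
  rw [h, norm_mul]
  have h0 := norm_sum_le (polyLT k 0) fun u => φ ((p * u) ^ 3)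
  rw [Finset.sum_congr rfl fun x _ => norm_addChar_polynomial φ _] at h0
  simp only [Finset.sum_const, card_polyLT, pow_zero, one_smul] at h0
  rw [norm_pow, Complex.norm_natCast]
  exact mul_le_of_le_one_right (by positivity) h0

lemma cubicSum_prime_pow_add_three (h3 : (3 : k) ≠ 0) {φ : AddChar k[X] ℂ} {p : k[X]}
    (hp : p.Monic) (hirr : Irreducible p) (m : ℕ) (hφ : HasLevel φ (p ^ (m + 3))) :
    cubicSum φ (p ^ (m + 3)).natDegree = (Fintype.card k : ℂ) ^ (2 * p.natDegree) *
      cubicSum (φ.mulShift (p ^ 3)) (p ^ m).natDegree := by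
  have hlev : HasLevel (φ.mulShift (p ^ 3)) (p ^ m) :=
    HasLevel.mulShift_of_mul (hp.pow 3).ne_zero (by rwa [← pow_add, add_comm])
  have hdeg : (m + 1) * p.natDegree = (p ^ m).natDegree + p.natDegree := by
    rw [hp.natDegree_pow]; ring
  have h := cubicSum_prime_pow h3 hp hirr (m + 1) (φ := φ) hφ
  rw [show m + 1 + 2 = m + 3 by ring] at h
  rw [h, hdeg, sum_polyLT_add (hp.pow m), cubicSum, two_mul, pow_add, mul_assoc]
  congr 1
  rw [Finset.mul_sum]
  refine Finset.sum_congr rfl fun y _ => ?_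
  have e : ∀ z, φ ((p * (y + p ^ m * z)) ^ 3) = φ.mulShift (p ^ 3) (y ^ 3) := fun z => by
    rw [mul_pow, ← AddChar.mulShift_apply]
    exact hlev.apply_congr ⟨3 * y ^ 2 * z + 3 * y * p ^ m * z ^ 2 + p ^ (2 * m) * z ^ 3, by ring⟩
  simp [e, card_polyLT]

lemma sq_norm_cubicSum_prime_le {φ : AddChar k[X] ℂ} {p : k[X]} (hp : p.Monic)
    (hirr : Irreducible p) (hφ : HasLevel φ p) :
    ‖cubicSum φ p.natDegree‖ ^ 2 ≤ 18 * (Fintype.card k : ℝ) ^ p.natDegree := by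
  have _ : Fact (Irreducible p) := ⟨hirr⟩
  have hmk : ∀ x y : k[X], AdjoinRoot.mk p x = AdjoinRoot.mk p y → φ x = φ y :=
    fun x y h => hφ.apply_congr (AdjoinRoot.mk_eq_mk.1 h)
  have hsurj : Function.Surjective (AdjoinRoot.mk p) := AdjoinRoot.mk_surjective
  -- `χ` is the character that `φ` induces on the residue field `𝔽_q[t] / π`.
  let out : AdjoinRoot p → k[X] := Function.surjInv hsurj
  have hout : ∀ a, AdjoinRoot.mk p (out a) = a := Function.surjInv_eq hsurj
  let χ : AddChar (AdjoinRoot p) ℂ :=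
    { toFun := fun a => φ (out a)
      map_zero_eq_one' := by
        rw [hmk (out 0) 0 (by rw [hout, map_zero]), AddChar.map_zero_eq_one]
      map_add_eq_mul' := fun a b => by
        rw [← AddChar.map_add_eq_mul]
        exact hmk _ _ (by rw [map_add, hout, hout, hout]) }
  have hχ : ∀ x, χ (AdjoinRoot.mk p x) = φ x := fun x => hmk _ _ (hout _)
  have hbij : Set.BijOn (AdjoinRoot.mk p) (polyLT k p.natDegree : Set k[X]) Set.univ := by
    refine ⟨fun _ _ => trivial, fun x hx y hy h => ?_, fun a _ => ?_⟩
    · rw [Finset.mem_coe] at hx hy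
      rw [← sub_eq_zero]
      refine eq_zero_of_dvd_of_mem_polyLT (AdjoinRoot.mk_eq_mk.1 h) ?_
      rw [mem_polyLT] at *
      exact (degree_sub_le _ _).trans_lt (max_lt hx hy)
    · refine ⟨out a %ₘ p, modByMonic_mem_polyLT hp _, ?_⟩
      rw [← hout a, AdjoinRoot.mk_eq_mk, hout]
      exact ⟨-(out a /ₘ p), by linear_combination modByMonic_add_div (out a) p⟩
  have _ : Fintype (AdjoinRoot p) := by
    have : (Set.univ : Set (AdjoinRoot p)).Finite := by
      rw [← hbij.image_eq]; exact (Finset.finite_toSet _).image _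
    exact @Fintype.ofFinite _ (Set.finite_univ_iff.1 this)
  have hsum : ∀ {M : Type} [AddCommMonoid M] (f : AdjoinRoot p → M),
      ∑ x ∈ polyLT k p.natDegree, f (AdjoinRoot.mk p x) = ∑ a, f a := by
    intro M _ f
    refine Finset.sum_nbij (AdjoinRoot.mk p) (fun _ _ => Finset.mem_univ _) hbij.injOn ?_
      fun _ _ => rfl
    rw [Finset.coe_univ]; exact hbij.surjOn
  have hprim : χ.IsPrimitive := by
    intro a ha
    obtain ⟨y, rfl⟩ := hsurj a
    rw [ne_eq, AdjoinRoot.mk_eq_zero, ← hφ] at ha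
    push Not at ha
    obtain ⟨x, hx⟩ := ha
    refine AddChar.ne_one_iff.2 ⟨AdjoinRoot.mk p x, ?_⟩
    rwa [AddChar.mulShift_apply, ← map_mul, hχ, mul_comm]
  have h := sq_norm_cubicSum_field_le hprim
  have hcard : Fintype.card (AdjoinRoot p) = Fintype.card k ^ p.natDegree := by
    have := hsum fun _ => (1 : ℕ)
    simpa [card_polyLT] using this.symm
  rw [← hsum fun a => χ (a ^ 3), hcard] at h
  simp only [← map_pow, hχ] at h
  exact_mod_cast h

/-! ### The normalised size of cubic sums modulo `r` -/

/-- The largest value of `|r|⁻¹ |∑_{x mod r} φ(x³)|` over the characters `φ` of level `r`. -/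
noncomputable def cubicSup (r : k[X]) : ℝ :=
  sSup {c | ∃ φ : AddChar k[X] ℂ, HasLevel φ r ∧
    c = ‖cubicSum φ r.natDegree‖ / (Fintype.card k : ℝ) ^ r.natDegree}

lemma card_pow_pos (k : Type*) [Field k] [Fintype k] (d : ℕ) : (0 : ℝ) < (Fintype.card k : ℝ) ^ d :=
  pow_pos (by linarith [one_lt_card_real k]) _

lemma cubicSup_nonneg (r : k[X]) : 0 ≤ cubicSup r := by
  refine Real.sSup_nonneg ?_
  rintro c ⟨φ, -, rfl⟩
  positivity

lemma cubicSup_le {r : k[X]} {c : ℝ} (hc : 0 ≤ c) (h : ∀ φ : AddChar k[X] ℂ, HasLevel φ r →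
    ‖cubicSum φ r.natDegree‖ ≤ (Fintype.card k : ℝ) ^ r.natDegree * c) : cubicSup r ≤ c := by
  refine Real.sSup_le ?_ hc
  rintro d ⟨φ, hφ, rfl⟩
  rw [div_le_iff₀' (card_pow_pos k _)]
  exact h φ hφ

lemma cubicSup_le_one (r : k[X]) : cubicSup r ≤ 1 :=
  cubicSup_le zero_le_one fun φ _ => by rw [mul_one]; exact norm_cubicSum_le φ _

lemma norm_cubicSum_le_cubicSup {φ : AddChar k[X] ℂ} {r : k[X]} (hφ : HasLevel φ r) :
    ‖cubicSum φ r.natDegree‖ ≤ (Fintype.card k : ℝ) ^ r.natDegree * cubicSup r := by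
  rw [← div_le_iff₀' (card_pow_pos k _)]
  refine le_csSup ⟨1, ?_⟩ ⟨φ, hφ, rfl⟩
  rintro c ⟨φ, -, rfl⟩
  rw [div_le_one (card_pow_pos k _)]
  exact norm_cubicSum_le φ _

lemma cubicSup_mul_le {r s : k[X]} (hr : r ≠ 0) (hs : s ≠ 0) (h : IsCoprime r s) :
    cubicSup (r * s) ≤ cubicSup r * cubicSup s := by
  refine cubicSup_le (mul_nonneg (cubicSup_nonneg r) (cubicSup_nonneg s)) fun φ hφ => ?_
  rw [cubicSum_mul hr hs h hφ, norm_mul, natDegree_mul hr hs, pow_add, mul_mul_mul_comm]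
  have h1 : HasLevel ((φ.mulShift s).mulShift (s ^ 2)) r :=
    (HasLevel.mulShift_of_mul hs (by rwa [mul_comm])).mulShift_of_isCoprime (h.symm.pow_left)
  have h2 : HasLevel ((φ.mulShift r).mulShift (r ^ 2)) s :=
    (HasLevel.mulShift_of_mul hr hφ).mulShift_of_isCoprime (h.pow_left)
  exact mul_le_mul (norm_cubicSum_le_cubicSup h1) (norm_cubicSum_le_cubicSup h2) (norm_nonneg _)
    (mul_nonneg (card_pow_pos k _).le (cubicSup_nonneg r))

/-- The term `|r| γ(r)⁵` that bounds the contribution of `r` to the singular series in at least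
five variables, where `γ` is `cubicSup`. -/
noncomputable def seriesTerm (r : k[X]) : ℝ :=
  (Fintype.card k : ℝ) ^ r.natDegree * cubicSup r ^ 5

lemma seriesTerm_nonneg (r : k[X]) : 0 ≤ seriesTerm r :=
  mul_nonneg (card_pow_pos k _).le (pow_nonneg (cubicSup_nonneg r) 5)

lemma seriesTerm_one_le : seriesTerm (1 : k[X]) ≤ 1 := by
  rw [seriesTerm, natDegree_one, pow_zero, one_mul]
  exact pow_le_one₀ (cubicSup_nonneg _) (cubicSup_le_one _)

lemma seriesTerm_mul_le {r s : k[X]} (hr : r ≠ 0) (hs : s ≠ 0) (h : IsCoprime r s) :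
    seriesTerm (r * s) ≤ seriesTerm r * seriesTerm s := by
  rw [seriesTerm, seriesTerm, seriesTerm, natDegree_mul hr hs, pow_add, mul_mul_mul_comm, ← mul_pow]
  exact mul_le_mul_of_nonneg_left (pow_le_pow_left₀ (cubicSup_nonneg _) (cubicSup_mul_le hr hs h) 5)
    (mul_pos (card_pow_pos k _) (card_pow_pos k _)).le

/-- `q ^ (-1/2)`. -/
noncomputable def invSqrtCard (k : Type*) [Field k] [Fintype k] : ℝ := (√(Fintype.card k : ℝ))⁻¹

lemma invSqrtCard_pos : 0 < invSqrtCard k :=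
  inv_pos.2 (Real.sqrt_pos.2 (by linarith [one_lt_card_real k]))

lemma card_mul_sq_invSqrtCard : (Fintype.card k : ℝ) * invSqrtCard k ^ 2 = 1 := by
  have := one_lt_card_real k
  rw [invSqrtCard, inv_pow, Real.sq_sqrt (by linarith), mul_inv_cancel₀ (by linarith)]

lemma invSqrtCard_lt_one : invSqrtCard k < 1 := by
  have h := card_mul_sq_invSqrtCard (k := k)
  by_contra! h1
  nlinarith [one_lt_card_real k, one_le_pow₀ (n := 2) h1]

/-- The decay of the singular series at prime powers: `|π|^{-3/2}` at `π` from square-root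
cancellation, and `|π|^{-3}` and `|π|^{-2}` at `π²` and `π³`. Each further factor `π³` saves
`|π|^{-2} ≤ 1/4 ≤ (2/3)³`, so that a geometric decay of ratio `2/3` is kept. -/
lemma seriesTerm_prime_pow_le (h3 : (3 : k) ≠ 0) {p : k[X]} (hp : p.Monic) (hirr : Irreducible p) :
    ∀ m : ℕ, seriesTerm (p ^ (m + 1)) ≤
      5000 * invSqrtCard k ^ (3 * p.natDegree) * (2 / 3) ^ (m + 1) := by
  -- `N = |π|` and `T = |π|^{-1/2}`.
  set N : ℝ := (Fintype.card k : ℝ) ^ p.natDegree with hN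
  set T : ℝ := invSqrtCard k ^ p.natDegree with hT
  have hNpos : 0 < N := card_pow_pos k _
  have hTpos : 0 < T := pow_pos invSqrtCard_pos _
  have hNT : N * T ^ 2 = 1 := by
    rw [hN, hT, ← pow_mul, mul_comm _ 2, pow_mul, ← mul_pow, card_mul_sq_invSqrtCard, one_pow]
  have hN2 : 2 ≤ N := by
    have h1 : (2 : ℝ) ≤ Fintype.card k := by exact_mod_cast Fintype.one_lt_card
    exact h1.trans (le_self_pow₀ (by linarith) hirr.natDegree_pos.ne')
  have hT2 : T ^ 2 ≤ 1 / 2 := by nlinarith [sq_nonneg T]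
  have hT1 : T ≤ 1 := by nlinarith
  have hT3 : invSqrtCard k ^ (3 * p.natDegree) = T ^ 3 := by rw [hT, ← pow_mul, mul_comm]
  have hdeg : ∀ m, (Fintype.card k : ℝ) ^ (p ^ m).natDegree = N ^ m := fun m => by
    rw [hp.natDegree_pow, hN, ← pow_mul, mul_comm]
  have hterm : ∀ m, seriesTerm (p ^ m) = N ^ m * cubicSup (p ^ m) ^ 5 := fun m => by
    rw [seriesTerm, hdeg]
  have step : ∀ m, seriesTerm (p ^ (m + 3)) ≤ T ^ 4 * seriesTerm (p ^ m) := by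
    intro m
    have h : cubicSup (p ^ (m + 3)) ≤ T ^ 2 * cubicSup (p ^ m) := by
      refine cubicSup_le (mul_nonneg (sq_nonneg T) (cubicSup_nonneg _)) fun φ hφ => ?_
      have hlev : HasLevel (φ.mulShift (p ^ 3)) (p ^ m) :=
        HasLevel.mulShift_of_mul (hp.pow 3).ne_zero (by rwa [← pow_add, add_comm])
      have h1 := norm_cubicSum_le_cubicSup hlev
      rw [hdeg] at h1
      rw [cubicSum_prime_pow_add_three h3 hp hirr m hφ, norm_mul, norm_pow, Complex.norm_natCast,
        hdeg, mul_comm 2, pow_mul, ← hN]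
      calc N ^ 2 * ‖cubicSum (φ.mulShift (p ^ 3)) (p ^ m).natDegree‖
          ≤ N ^ 2 * (N ^ m * cubicSup (p ^ m)) := mul_le_mul_of_nonneg_left h1 (by positivity)
        _ = N ^ (m + 2) * (N * T ^ 2) * cubicSup (p ^ m) := by rw [hNT]; ring
        _ = N ^ (m + 3) * (T ^ 2 * cubicSup (p ^ m)) := by ring
    calc seriesTerm (p ^ (m + 3)) ≤ N ^ (m + 3) * (T ^ 2 * cubicSup (p ^ m)) ^ 5 := by
          rw [hterm]
          exact mul_le_mul_of_nonneg_left (pow_le_pow_left₀ (cubicSup_nonneg _) h 5) (by positivity)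
      _ = (N * T ^ 2) ^ 3 * T ^ 4 * (N ^ m * cubicSup (p ^ m) ^ 5) := by ring
      _ = T ^ 4 * seriesTerm (p ^ m) := by rw [hNT, hterm]; ring
  have hT4 : T ^ 4 ≤ 8 / 27 := by nlinarith [sq_nonneg T]
  have h43 : T ^ 4 ≤ T ^ 3 := pow_le_pow_of_le_one hTpos.le hT1 (by norm_num)
  have h63 : T ^ 6 ≤ T ^ 3 := pow_le_pow_of_le_one hTpos.le hT1 (by norm_num)
  have hT3pos : 0 < T ^ 3 := by positivity
  have one : seriesTerm (p ^ 1) ≤ 3125 * T ^ 3 := by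
    have h : cubicSup (p ^ 1) ≤ 5 * T := by
      rw [pow_one]
      refine cubicSup_le (by positivity) fun φ hφ => ?_
      refine abs_le_of_sq_le_sq' ?_ (by positivity) |>.2
      refine (sq_norm_cubicSum_prime_le hp hirr hφ).trans ?_
      rw [← hN]
      have : (N * (5 * T)) ^ 2 = 25 * N * (N * T ^ 2) := by ring
      rw [this, hNT]
      linarith
    calc seriesTerm (p ^ 1) ≤ N ^ 1 * (5 * T) ^ 5 := by
          rw [hterm]
          exact mul_le_mul_of_nonneg_left (pow_le_pow_left₀ (cubicSup_nonneg _) h 5) (by positivity)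
      _ = (N * T ^ 2) * (3125 * T ^ 3) := by ring
      _ = 3125 * T ^ 3 := by rw [hNT, one_mul]
  have two : seriesTerm (p ^ 2) ≤ T ^ 6 := by
    have h : cubicSup (p ^ 2) ≤ T ^ 2 := by
      refine cubicSup_le (by positivity) fun φ hφ => ?_
      refine (norm_cubicSum_prime_sq_le h3 hp hirr hφ).trans ?_
      rw [hdeg, ← hN, sq N, mul_assoc, hNT, mul_one]
    calc seriesTerm (p ^ 2) ≤ N ^ 2 * (T ^ 2) ^ 5 := by
          rw [hterm]
          exact mul_le_mul_of_nonneg_left (pow_le_pow_left₀ (cubicSup_nonneg _) h 5) (by positivity)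
      _ = (N * T ^ 2) ^ 2 * T ^ 6 := by ring
      _ = T ^ 6 := by rw [hNT, one_pow, one_mul]
  have three : seriesTerm (p ^ 3) ≤ T ^ 4 := by
    have h := step 0
    rw [pow_zero, zero_add] at h
    exact h.trans (mul_le_of_le_one_right (by positivity) seriesTerm_one_le)
  rw [hT3]
  intro m
  induction m using Nat.strong_induction_on with
  | _ m ih =>
    match m with
    | 0 => exact one.trans (by linarith)
    | 1 => exact two.trans (by norm_num; linarith)
    | 2 => exact three.trans (by norm_num; linarith)
    | m + 3 =>
      refine (step (m + 1)).trans ?_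
      calc T ^ 4 * seriesTerm (p ^ (m + 1))
          ≤ 8 / 27 * (5000 * T ^ 3 * (2 / 3) ^ (m + 1)) :=
            mul_le_mul hT4 (ih m (by omega)) (seriesTerm_nonneg _) (by norm_num)
        _ = 5000 * T ^ 3 * (2 / 3) ^ (m + 3 + 1) := by ring

lemma sum_seriesTerm_prime_pow_le (h3 : (3 : k) ≠ 0) {p : k[X]} (hp : p.Monic)
    (hirr : Irreducible p) (D : ℕ) : ∑ m ∈ Finset.range (D + 1), seriesTerm (p ^ m) ≤
      1 + 10000 * invSqrtCard k ^ (3 * p.natDegree) := by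
  have hgeom : ∑ m ∈ Finset.range D, (2 / 3 : ℝ) ^ (m + 1) ≤ 2 := by
    have h := geom_sum_eq (x := (2 / 3 : ℝ)) (by norm_num) D
    simp_rw [pow_succ]
    rw [← Finset.sum_mul, h, show (2 / 3 - 1 : ℝ) = -(1 / 3) by norm_num]
    have : (0 : ℝ) ≤ (2 / 3) ^ D := by positivity
    linarith
  rw [Finset.sum_range_succ', pow_zero, add_comm]
  refine add_le_add seriesTerm_one_le ?_
  refine (Finset.sum_le_sum fun m _ => seriesTerm_prime_pow_le h3 hp hirr m).trans ?_
  rw [← Finset.mul_sum]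
  have : 0 < invSqrtCard k ^ (3 * p.natDegree) := pow_pos invSqrtCard_pos _
  nlinarith

/-! ### Convergence of the singular series -/

open Classical in
/-- The monic polynomials of degree at most `D` whose monic irreducible factors all lie in `s`. -/
noncomputable def smoothMonics (s : Finset k[X]) (D : ℕ) : Finset k[X] :=
  (polyLT k (D + 1)).filter fun r => r.Monic ∧ ∀ p : k[X], p.Monic → Irreducible p → p ∣ r → p ∈ s

lemma mem_smoothMonics {s : Finset k[X]} {D : ℕ} {r : k[X]} : r ∈ smoothMonics s D ↔
    r.Monic ∧ r.natDegree ≤ D ∧ ∀ p : k[X], p.Monic → Irreducible p → p ∣ r → p ∈ s := by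
  classical
  rw [smoothMonics, Finset.mem_filter, mem_polyLT]
  constructor
  · rintro ⟨h1, h2, h3⟩
    rw [degree_eq_natDegree h2.ne_zero, Nat.cast_lt] at h1
    exact ⟨h2, by omega, h3⟩
  · rintro ⟨h1, h2, h3⟩
    refine ⟨?_, h1, h3⟩
    rw [degree_eq_natDegree h1.ne_zero, Nat.cast_lt]
    omega

/-- A finite Euler product bounds the sum of a submultiplicative function. -/
lemma sum_seriesTerm_smoothMonics_le (h3 : (3 : k) ≠ 0) (D : ℕ) (s : Finset k[X])
    (hs : ∀ p ∈ s, p.Monic ∧ Irreducible p) : ∑ r ∈ smoothMonics s D, seriesTerm r ≤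
      ∏ p ∈ s, (1 + 10000 * invSqrtCard k ^ (3 * p.natDegree)) := by
  classical
  induction s using Finset.induction_on with
  | empty =>
    rw [Finset.prod_empty]
    refine le_trans (Finset.sum_le_sum_of_subset_of_nonneg (t := {1}) ?_
      fun _ _ _ => seriesTerm_nonneg _) (by rw [Finset.sum_singleton]; exact seriesTerm_one_le)
    intro r hr
    obtain ⟨h1, -, h2⟩ := mem_smoothMonics.1 hr
    rw [Finset.mem_singleton]
    by_contra hr1
    obtain ⟨p, hp1, hp2, hp3⟩ := exists_monic_irreducible_factor r
      fun hu => hr1 (h1.isUnit_iff.1 hu)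
    exact absurd (h2 p hp1 hp2 hp3) (Finset.notMem_empty p)
  | insert p s hps ih =>
    obtain ⟨hp, hirr⟩ := hs p (Finset.mem_insert_self p s)
    -- Split off the exact power of `p` that divides `r`.
    have hsub : smoothMonics (insert p s) D ⊆
        (Finset.range (D + 1) ×ˢ smoothMonics s D).image fun x => p ^ x.1 * x.2 := by
      intro r hr
      obtain ⟨h1, h2, h4⟩ := mem_smoothMonics.1 hr
      obtain ⟨m, u, hu, rfl⟩ := WfDvdMonoid.max_power_factor h1.ne_zero hirr
      have hum : u.Monic := (hp.pow m).of_mul_monic_left h1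
      rw [(hp.pow m).natDegree_mul hum, hp.natDegree_pow] at h2
      have hpos := hirr.natDegree_pos
      refine Finset.mem_image.2 ⟨(m, u), Finset.mem_product.2 ⟨Finset.mem_range.2 ?_, ?_⟩, rfl⟩
      · have : m * 1 ≤ m * p.natDegree := Nat.mul_le_mul_left m hpos
        simp only; omega
      · refine mem_smoothMonics.2 ⟨hum, by simp only; omega, fun l hl hl' hlu => ?_⟩
        refine Finset.mem_of_mem_insert_of_ne (h4 l hl hl' (hlu.mul_left _)) ?_
        rintro rfl
        exact hu hlu
    rw [Finset.prod_insert hps]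
    calc ∑ r ∈ smoothMonics (insert p s) D, seriesTerm r
        ≤ ∑ r ∈ (Finset.range (D + 1) ×ˢ smoothMonics s D).image fun x => p ^ x.1 * x.2,
            seriesTerm r :=
          Finset.sum_le_sum_of_subset_of_nonneg hsub fun _ _ _ => seriesTerm_nonneg _
      _ ≤ ∑ x ∈ Finset.range (D + 1) ×ˢ smoothMonics s D, seriesTerm (p ^ x.1 * x.2) :=
          Finset.sum_image_le_of_nonneg fun _ _ => seriesTerm_nonneg _
      _ ≤ ∑ x ∈ Finset.range (D + 1) ×ˢ smoothMonics s D,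
            seriesTerm (p ^ x.1) * seriesTerm x.2 := by
          refine Finset.sum_le_sum fun x hx => ?_
          obtain ⟨h1, -, h4⟩ := mem_smoothMonics.1 (Finset.mem_product.1 hx).2
          refine seriesTerm_mul_le (hp.pow _).ne_zero h1.ne_zero (IsCoprime.pow_left ?_)
          exact hirr.coprime_iff_not_dvd.2 fun h => hps (h4 p hp hirr h)
      _ = (∑ m ∈ Finset.range (D + 1), seriesTerm (p ^ m)) *
            ∑ r ∈ smoothMonics s D, seriesTerm r := by
          rw [Finset.sum_product, Finset.sum_mul_sum]
      _ ≤ _ := by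
          refine mul_le_mul (sum_seriesTerm_prime_pow_le h3 hp hirr D)
            (ih fun l hl => hs l (Finset.mem_insert_of_mem hl))
            (Finset.sum_nonneg fun _ _ => seriesTerm_nonneg _) ?_
          have : 0 < invSqrtCard k ^ (3 * p.natDegree) := pow_pos invSqrtCard_pos _
          positivity

/-- `∑ |f|^{-3/2}` converges, since there are at most `q ^ (d + 1)` polynomials of degree `d`. -/
lemma sum_invSqrtCard_pow_le (s : Finset k[X]) :
    ∑ p ∈ s, invSqrtCard k ^ (3 * p.natDegree) ≤ Fintype.card k * (1 - invSqrtCard k)⁻¹ := by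
  classical
  have ht := invSqrtCard_pos (k := k)
  have ht1 := invSqrtCard_lt_one (k := k)
  have hmaps : ∀ p ∈ s, p.natDegree ∈ Finset.range (s.sup natDegree + 1) := fun p hp =>
    Finset.mem_range.2 (Nat.lt_succ_of_le (Finset.le_sup (f := natDegree) hp))
  rw [← Finset.sum_fiberwise_of_maps_to hmaps]
  calc ∑ d ∈ Finset.range (s.sup natDegree + 1), ∑ p ∈ s with p.natDegree = d,
        invSqrtCard k ^ (3 * p.natDegree)
      ≤ ∑ d ∈ Finset.range (s.sup natDegree + 1), Fintype.card k * invSqrtCard k ^ d := by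
        refine Finset.sum_le_sum fun d _ => ?_
        have hcard : (s.filter fun p => p.natDegree = d).card ≤ Fintype.card k ^ (d + 1) := by
          rw [← card_polyLT]
          refine Finset.card_le_card fun p hp => mem_polyLT.2 ?_
          rw [← (Finset.mem_filter.1 hp).2]
          exact degree_le_natDegree.trans_lt (by exact_mod_cast Nat.lt_succ_self _)
        rw [Finset.sum_congr rfl fun p hp => by rw [(Finset.mem_filter.1 hp).2], Finset.sum_const,
          nsmul_eq_mul]
        calc ((s.filter fun p => p.natDegree = d).card : ℝ) * invSqrtCard k ^ (3 * d)
            ≤ (Fintype.card k : ℝ) ^ (d + 1) * invSqrtCard k ^ (3 * d) :=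
              mul_le_mul_of_nonneg_right (by exact_mod_cast hcard) (by positivity)
          _ = Fintype.card k * invSqrtCard k ^ d * (Fintype.card k * invSqrtCard k ^ 2) ^ d := by
              ring
          _ = _ := by rw [card_mul_sq_invSqrtCard, one_pow, mul_one]
    _ ≤ Fintype.card k * (1 - invSqrtCard k)⁻¹ := by
        rw [← Finset.mul_sum]
        refine mul_le_mul_of_nonneg_left ?_ (by positivity)
        rw [← tsum_geometric_of_lt_one ht.le ht1]
        exact (summable_geometric_of_lt_one ht.le ht1).sum_le_tsum _ fun _ _ => by positivity

/-- The singular series converges absolutely in at least five variables. -/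
lemma exists_sum_seriesTerm_le (h3 : (3 : k) ≠ 0) : ∃ C : ℝ, 0 < C ∧
    ∀ s : Finset k[X], (∀ r ∈ s, r.Monic) → ∑ r ∈ s, seriesTerm r ≤ C := by
  classical
  refine ⟨Real.exp (10000 * (Fintype.card k * (1 - invSqrtCard k)⁻¹)), Real.exp_pos _,
    fun s hs => ?_⟩
  set D := s.sup natDegree with hD
  set primes := (polyLT k (D + 1)).filter fun p => p.Monic ∧ Irreducible p with hprimes
  have hsub : s ⊆ smoothMonics primes D := by
    intro r hr
    have hrD : r.natDegree ≤ D := Finset.le_sup (f := natDegree) hr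
    refine mem_smoothMonics.2 ⟨hs r hr, hrD, fun p hp hirr hpr => ?_⟩
    refine Finset.mem_filter.2 ⟨mem_polyLT.2 ?_, hp, hirr⟩
    rw [degree_eq_natDegree hp.ne_zero, Nat.cast_lt, Nat.lt_succ_iff]
    exact (natDegree_le_of_dvd hpr (hs r hr).ne_zero).trans hrD
  calc ∑ r ∈ s, seriesTerm r ≤ ∑ r ∈ smoothMonics primes D, seriesTerm r :=
        Finset.sum_le_sum_of_subset_of_nonneg hsub fun _ _ _ => seriesTerm_nonneg _
    _ ≤ ∏ p ∈ primes, (1 + 10000 * invSqrtCard k ^ (3 * p.natDegree)) :=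
        sum_seriesTerm_smoothMonics_le h3 D primes fun p hp => (Finset.mem_filter.1 hp).2
    _ ≤ _ := by
        have ht : ∀ p : k[X], 0 ≤ 10000 * invSqrtCard k ^ (3 * p.natDegree) := fun p =>
          mul_nonneg (by norm_num) (pow_pos invSqrtCard_pos _).le
        refine (Real.prod_one_add_le_exp_sum primes ht).trans ?_
        rw [← Finset.mul_sum]
        exact Real.exp_le_exp.2 (mul_le_mul_of_nonneg_left (sum_invSqrtCard_pow_le primes)
          (by norm_num))

/-! ### The exponential sums `S_r(𝟎)` -/

/-- The character `x ↦ ψ(x / r)` of `𝔽_q[t]`. -/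
noncomputable def psiDiv (r : k[X]) : AddChar k[X] ℂ where
  toFun x := psi (toKinf k x / toKinf k r)
  map_zero_eq_one' := by rw [map_zero, zero_div]; exact psi_eq_one rfl
  map_add_eq_mul' x y := by rw [map_add, add_div, psi_add]

lemma psiDiv_apply (r x : k[X]) : psiDiv r x = psi (toKinf k x / toKinf k r) := rfl

/-- If `r ∤ y`, the fractional part of `y / r` has a leading coefficient, which a suitable
monomial moves to the place seen by `ψ`. -/
lemma hasLevel_psiDiv {r : k[X]} (hr : r.Monic) : HasLevel (psiDiv r) r := by
  have hr0 := toKinf_ne_zero hr.ne_zero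
  have hdvd : ∀ x, r ∣ x → psiDiv r x = 1 := by
    rintro _ ⟨s, rfl⟩
    rw [psiDiv_apply, map_mul, mul_div_cancel_left₀ _ hr0, psi_toKinf]
  refine fun y => ⟨fun h => ?_, fun h x => hdvd _ (h.mul_left x)⟩
  rw [← modByMonic_eq_zero_iff_dvd hr]
  by_contra hy0
  set y₀ := y %ₘ r with hy₀
  have h' : ∀ x, psiDiv r (x * y₀) = 1 := by
    intro x
    have e : x * y₀ = x * y + r * (-(x * (y /ₘ r))) := by
      linear_combination x * modByMonic_add_div y r
    rw [e, AddChar.map_add_eq_mul, h, hdvd _ (dvd_mul_right _ _), one_mul]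
  set α := toKinf k y₀ / toKinf k r with hα
  have hα0 : α ≠ 0 := div_ne_zero (toKinf_ne_zero hy0) hr0
  have hord : 0 < α.order := by
    have h1 : α * toKinf k r = toKinf k y₀ := div_mul_cancel₀ _ hr0
    have h2 := congrArg HahnSeries.order h1
    rw [HahnSeries.order_mul hα0 hr0, order_toKinf hr.ne_zero, order_toKinf hy0] at h2
    have h3 := degree_modByMonic_lt y hr
    rw [← hy₀, degree_eq_natDegree hy0, degree_eq_natDegree hr.ne_zero, Nat.cast_lt] at h3
    omega
  obtain ⟨u, hu⟩ := exists_traceChar_mul_ne_one (HahnSeries.coeff_order_eq_zero.not.2 hα0)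
  apply hu
  rw [← h' (C u * X ^ (α.order - 1).toNat), psiDiv_apply, map_mul (toKinf k), toKinf_C_mul_X_pow,
    mul_div_assoc, ← hα, mul_comm (HahnSeries.single _ u), psi_eq_traceChar, coeff_mul_single]
  congr 3
  omega

lemma eval_diagonalCubic {k : Type*} [Field k] (a : Fin n → kˣ) (x : Fin n → k[X]) :
    MvPolynomial.eval x (diagonalCubic a) = ∑ i, C (a i : k) * x i ^ 3 := by
  simp [diagonalCubic]

lemma expSum_diagonalCubic_eq (a : Fin n → kˣ) {r : k[X]} (hr : r.Monic) [DecidablePred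
    fun b : k[X] => IsCoprime b r] : expSum (diagonalCubic a) r 0 =
      ∑ b ∈ (polyLT k r.natDegree).filter fun b => IsCoprime b r,
        ∏ i, cubicSum ((psiDiv r).mulShift (b * C (a i : k))) r.natDegree := by
  have hb : {b : k[X] | absO b < absO r ∧ IsCoprime b r} =
      ((polyLT k r.natDegree).filter fun b => IsCoprime b r : Finset k[X]) := by
    ext b
    simp [mem_polyLT, absO_lt_absO_iff hr.ne_zero]
  have hx : {x : Fin n → k[X] | ∀ i, absO (x i) < absO r} =
      (Fintype.piFinset fun _ => polyLT k r.natDegree : Finset (Fin n → k[X])) := by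
    ext x
    simp [mem_polyLT, absO_lt_absO_iff hr.ne_zero]
  rw [expSum, hb, hx, finsum_mem_coe_finset]
  refine Finset.sum_congr rfl fun b _ => ?_
  simp only [cubicSum]
  rw [finsum_mem_coe_finset, Finset.prod_univ_sum]
  refine Finset.sum_congr rfl fun x _ => ?_
  have e : b * MvPolynomial.eval x (diagonalCubic a) - ∑ i, (0 : Fin n → k[X]) i * x i =
      ∑ i, b * C (a i : k) * x i ^ 3 := by
    simp [eval_diagonalCubic, Finset.mul_sum, mul_assoc]
  rw [e, map_sum, Finset.sum_div, psi_sum]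
  rfl

lemma norm_expSum_le (a : Fin n → kˣ) {r : k[X]} (hr : r.Monic) :
    ‖expSum (diagonalCubic a) r 0‖ ≤
      (Fintype.card k : ℝ) ^ r.natDegree *
        ((Fintype.card k : ℝ) ^ r.natDegree * cubicSup r) ^ n := by
  classical
  rw [expSum_diagonalCubic_eq a hr]
  have hnn : 0 ≤ (Fintype.card k : ℝ) ^ r.natDegree * cubicSup r :=
    mul_nonneg (card_pow_pos k _).le (cubicSup_nonneg r)
  refine (norm_sum_le_of_le (f := fun b : k[X] =>
    ∏ i, cubicSum ((psiDiv r).mulShift (b * C (a i : k))) r.natDegree) (n := fun _ =>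
    ((Fintype.card k : ℝ) ^ r.natDegree * cubicSup r) ^ n) _ fun b hb => ?_).trans ?_
  · rw [norm_prod]
    calc _ ≤ ∏ _i : Fin n, (Fintype.card k : ℝ) ^ r.natDegree * cubicSup r := by
          refine Finset.prod_le_prod (fun _ _ => norm_nonneg _) fun i _ => ?_
          refine norm_cubicSum_le_cubicSup ((hasLevel_psiDiv hr).mulShift_of_isCoprime ?_)
          exact (isCoprime_mul_unit_right_left (isUnit_C.2 (a i).isUnit) b r).2
            (Finset.mem_filter.1 hb).2
      _ = _ := by simp
  · rw [Finset.sum_const, nsmul_eq_mul]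
    refine mul_le_mul_of_nonneg_right ?_ (pow_nonneg hnn n)
    have h := Finset.card_filter_le (polyLT k r.natDegree) fun b => IsCoprime b r
    rw [card_polyLT] at h
    exact_mod_cast h

lemma finite_setOf_monic_absO_le (M : ℝ) : {r : k[X] | r.Monic ∧ absO r ≤ hat k M}.Finite := by
  refine (Finset.finite_toSet (polyLT k (⌊M⌋₊ + 1))).subset ?_
  rintro r ⟨hr, h⟩
  rw [absO_eq hr.ne_zero, ← Real.rpow_natCast] at h
  have h1 : (r.natDegree : ℝ) ≤ M := hat_le_hat_iff.1 h
  rw [Finset.mem_coe, mem_polyLT, degree_eq_natDegree hr.ne_zero, Nat.cast_lt, Nat.lt_succ_iff]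
  exact Nat.le_floor h1

end CubicCentre

theorem proposition9p1 (k : Type*) [Field k] [Fintype k] (hchar : 3 < ringChar k)
    (n : ℕ) (hn : 5 ≤ n) (a : Fin n → kˣ)
    (w : (Fin n → CubicCentre.Kinf k) → ℝ)
    (hw : CubicCentre.IsWeight (CubicCentre.diagonalCubic a) w) :
    ∃ C : ℝ, 0 < C ∧ ∀ (P : k[X]), P ≠ 0 → ∀ (Q : ℝ), 0 ≤ Q →
      ‖CubicCentre.centreTerm (CubicCentre.diagonalCubic a) w P Q‖
        ≤ C * CubicCentre.absO P ^ (n - 3) := by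
  open CubicCentre in
  have h3 := three_ne_zero_of_ringChar hchar
  obtain ⟨B, hB, hI⟩ := exists_norm_avgInt_le h3 (by omega) a hw
  obtain ⟨C, hC, hS⟩ := exists_sum_seriesTerm_le h3
  refine ⟨C * B, by positivity, fun P hP Q _ => ?_⟩
  have hP0 : 0 < absO P := by rw [absO_eq hP]; exact card_pow_pos k _
  have hfin := finite_setOf_monic_absO_le (k := k) Q
  have hmonic : ∀ r ∈ hfin.toFinset, r.Monic := fun r hr => (hfin.mem_toFinset.1 hr).1
  have hterm : ∀ r ∈ hfin.toFinset, ‖(((absO r ^ n)⁻¹ : ℝ) : ℂ) * expSum (diagonalCubic a) r 0 *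
      avgInt (diagonalCubic a) w P r Q 0‖ ≤ seriesTerm r * (B * (absO P ^ 3)⁻¹) := by
    intro r hr
    have hN := card_pow_pos k r.natDegree
    rw [norm_mul, norm_mul, Complex.norm_real, absO_eq (hmonic r hr).ne_zero,
      Real.norm_of_nonneg (by positivity)]
    refine mul_le_mul ?_ (hI P hP r Q) (norm_nonneg _) (seriesTerm_nonneg r)
    rw [inv_mul_le_iff₀ (by positivity)]
    refine (norm_expSum_le a (hmonic r hr)).trans ?_
    rw [seriesTerm, mul_pow, mul_left_comm]
    refine mul_le_mul_of_nonneg_left ?_ (by positivity)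
    refine mul_le_mul_of_nonneg_left ?_ hN.le
    -- This is where `n ≥ 5` enters.
    exact pow_le_pow_of_le_one (cubicSup_nonneg r) (cubicSup_le_one r) hn
  rw [centreTerm, finsum_mem_eq_finite_toFinset_sum _ hfin, norm_mul, Complex.norm_real,
    Real.norm_of_nonneg (by positivity)]
  calc absO P ^ n * ‖∑ r ∈ hfin.toFinset, (((absO r ^ n)⁻¹ : ℝ) : ℂ) *
        expSum (diagonalCubic a) r 0 * avgInt (diagonalCubic a) w P r Q 0‖
      ≤ absO P ^ n * (C * (B * (absO P ^ 3)⁻¹)) := by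
        refine mul_le_mul_of_nonneg_left ?_ (by positivity)
        refine (norm_sum_le_of_le _ hterm).trans ?_
        rw [← Finset.sum_mul]
        exact mul_le_mul_of_nonneg_right (hS _ hmonic) (by positivity)
    _ = C * B * absO P ^ (n - 3) := by
        rw [pow_sub₀ _ hP0.ne' (by omega)]
        ring
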